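/- Let $d,m\in\mathbb N$ and let $M_p$ be the set of point measures on $\mathbb R^d\times\{1,\dots,m\}$, i.e. of Borel measures taking values in $\mathbb N$ on relatively compact Borel sets, with the $\sigma$-algebra generated by the evaluations $\lambda\mapsto\lambda(A)$ (the Borel $\sigma$-algebra of the vague topology). For $\lambda\in M_p$ and $t\in\mathbb R^d$ let $T_t\lambda$ be the translate of $\lambda$ by $t$ (in the first coordinate). Let $\mu$ be a probability measure on $M_p$ (the law of an $m$-coloured point process) which is - uniformly discrete: for some $r>0$, $\mu$-almost every $\lambda$ satisfies $\lambda\big((a+C_r)\times\{1,\dots,m\}\big)\le 1$ for all $a\in\mathbb R^d$, where $C_R$ is the open cube of edge length $R$ about $0$; - stationary and ergodic for the translation action of $\mathbb R^d$. (If $X$ is the vague support of $\mu$, then $L^2(X,\mu)=L^2(M_p,\mu)$.) Let $w=(w_1,\dots,w_m)$ be real numbers, pairwise distinct and all nonzero, let $\lambda^w:=\sum_i w_i\,\lambda(\,\cdot\times\{i\})$, and let $N^w_f(\lambda):=\lambda^w(f)$. Let $\dot\mu^w_1$ be the weighted autocorrelation of $\mu$, that is, the first moment of the weighted Palm measure: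 $$\dot\mu^w_1(f)=\int\ \sum_{x\in C_1}\lambda^w(\{x\})\,N^w_f(T_{-x}\lambda)\,d\mu(\lambda).$$ Let $\mathbb S$ be the space of rapidly decreasing (Schwartz) functions $\mathbb R^d\to\mathbb C$, and $\hat f(k)=\int f(x)e^{-2\pi i k\cdot x}\,dx$. Then there are a positive tempered measure $\sigma=\widehat{\dot\mu^w_1}$ on $\mathbb R^d$ with $\int\varphi\,d\sigma=\dot\mu^w_1(\hat\varphi)$ for all $\varphi\in\mathbb S$, and a linear isometric embedding $\theta^w:L^2(\mathbb R^d,\sigma)\to L^2(X,\mu)$ with $\theta^w(\hat f)=N^w_f$ for all $f\in\mathbb S$. For every such $\sigma$ and $\theta^w$, the complex algebra $\Theta^w$ generated, under pointwise multiplication, by $\theta^w(\mathbb S)$ and the constant function $1_X$ is contained in $L^2(X,\mu)$ and is dense in $L^2(X,\mu)$. -/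

import Mathlib

open MeasureTheory Filter
open scoped ENNReal FourierTransform SchwartzMap

noncomputable section

namespace ColouredPointProcess

/-- The ambient Euclidean space `ℝ^d`. -/
abbrev Space (d : ℕ) : Type := EuclideanSpace ℝ (Fin d)

/-- The open cube of edge length `R` centred at `a`. -/
def cube {d : ℕ} (a : Space d) (R : ℝ) : Set (Space d) :=
  {x | ∀ i, |x i - a i| < R / 2}

/-- Point measures on `ℝ^d × {1, …, m}`: Borel measures that take values in `ℕ` on all
relatively compact Borel sets. -/
def IsPointMeasure {d m : ℕ} (ν : Measure (Space d × Fin m)) : Prop :=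
  ∀ A : Set (Space d × Fin m), MeasurableSet A → IsCompact (closure A) → ∃ n : ℕ, ν A = n

/-- The space `M_p` of point measures on `ℝ^d × {1, …, m}`. -/
def PointMeasure (d m : ℕ) : Type :=
  {ν : Measure (Space d × Fin m) // IsPointMeasure ν}

/-- The `σ`-algebra on point measures generated by the evaluations `ν ↦ ν A`; it is the Borel
`σ`-algebra of the vague topology. -/
instance (d m : ℕ) : MeasurableSpace (PointMeasure d m) :=
  inferInstanceAs (MeasurableSpace {ν : Measure (Space d × Fin m) // IsPointMeasure ν})

/-- Translation of coloured points: `(x, i) ↦ (t + x, i)`. -/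
def shift {d : ℕ} (m : ℕ) (t : Space d) : (Space d × Fin m) ≃ₜ (Space d × Fin m) :=
  (Homeomorph.addLeft t).prodCongr (Homeomorph.refl (Fin m))

theorem IsPointMeasure.map_shift {d m : ℕ} {ν : Measure (Space d × Fin m)}
    (hν : IsPointMeasure ν) (t : Space d) : IsPointMeasure (ν.map (shift m t)) := by
  intro A hA hc
  have hmeas : Measurable (shift m t) := (shift m t).continuous.measurable
  rw [Measure.map_apply hmeas hA]
  refine hν _ (hmeas hA) ?_
  rw [← (shift m t).preimage_closure]
  exact (shift m t).isCompact_preimage.mpr hc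

/-- The translation action of `ℝ^d` on point measures, `(t +ᵥ ν)(A) = ν (-t + A)`. -/
instance (d m : ℕ) : VAdd (Space d) (PointMeasure d m) where
  vadd t ν := ⟨ν.1.map (shift m t), ν.2.map_shift t⟩

/-- A point process (given by its law) is uniformly discrete if, for some `r > 0`, almost every
realisation has at most one point, whatever its colour, in each translate of the open cube of
edge length `r`. -/
def IsUniformlyDiscrete {d m : ℕ} (μ : Measure (PointMeasure d m)) : Prop :=
  ∃ r : ℝ, 0 < r ∧ ∀ᵐ ν ∂μ, ∀ a : Space d, ν.1 (cube a r ×ˢ Set.univ) ≤ 1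

/-- The weighted counting function `N^w_f(ν) = ν^w(f) = ∑_i w_i ∑_x ν({(x, i)}) f(x)`. -/
def weightedCount {d m : ℕ} (w : Fin m → ℝ) (f : Space d → ℂ) (ν : PointMeasure d m) : ℂ :=
  ∫ p, (w p.2 : ℂ) * f p.1 ∂ν.1

/-- The weighted Palm measure, as a functional on functions of point measures:
`F ↦ ∫ ∑_{x ∈ C} ν^w({x}) F(T_{-x} ν) dμ(ν)`, where `C` is the open cube of edge length `1`
about `0`, whose volume is `1`. -/
def weightedPalm {d m : ℕ} (μ : Measure (PointMeasure d m)) (w : Fin m → ℝ)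
    (F : PointMeasure d m → ℂ) : ℂ :=
  ∫ ν, ∫ p in cube (0 : Space d) 1 ×ˢ Set.univ, (w p.2 : ℂ) * F (-p.1 +ᵥ ν) ∂ν.1 ∂μ

/-- The weighted first moment of the weighted Palm measure (the weighted autocorrelation of the
process), as a functional on functions on `ℝ^d`. -/
def weightedAutocorrelation {d m : ℕ} (μ : Measure (PointMeasure d m)) (w : Fin m → ℝ)
    (f : Space d → ℂ) : ℂ :=
  weightedPalm μ w (weightedCount w f)

/-- `σ` is the Fourier transform of the weighted autocorrelation (the diffraction measure):
its integral against every rapidly decreasing `φ` is the autocorrelation at `𝓕 φ`. -/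
def IsDiffraction {d m : ℕ} (μ : Measure (PointMeasure d m)) (w : Fin m → ℝ)
    (σ : Measure (Space d)) [σ.HasTemperateGrowth] : Prop :=
  ∀ φ : 𝓢(Space d, ℂ), ∫ k, φ k ∂σ = weightedAutocorrelation μ w (𝓕 φ : 𝓢(Space d, ℂ))

/-- The isometric embedding `θ : L²(ℝ^d, σ) → L²(μ)` extends `𝓕 f ↦ N^w_f`, for rapidly
decreasing `f`. -/
def IsDiffractionEmbedding {d m : ℕ} (μ : Measure (PointMeasure d m)) (w : Fin m → ℝ)
    (σ : Measure (Space d)) [σ.HasTemperateGrowth] (θ : Lp ℂ 2 σ →ₗᵢ[ℂ] Lp ℂ 2 μ) : Prop :=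
  ∀ f : 𝓢(Space d, ℂ), θ ((𝓕 f).toLp 2 σ) =ᵐ[μ] weightedCount w f

/-- The unital algebra of functions (under pointwise operations) generated by the image under `θ`
of the Schwartz space. Every representative of an element of the image is a
generator, so that passing to classes modulo null sets gives the algebra of classes generated by
the image; the constant function `1` belongs to it. -/
def generatedAlgebra {d m : ℕ} {μ : Measure (PointMeasure d m)} {σ : Measure (Space d)}
    [σ.HasTemperateGrowth] (θ : Lp ℂ 2 σ →ₗᵢ[ℂ] Lp ℂ 2 μ) :
    Subalgebra ℂ (PointMeasure d m → ℂ) :=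
  Algebra.adjoin ℂ {F | ∃ φ : 𝓢(Space d, ℂ), F =ᵐ[μ] θ (φ.toLp 2 σ)}

end ColouredPointProcess

end

/-! Uniform discreteness bounds the sum of any rapidly decaying function over almost every
configuration by one constant, so each `weightedCount w f` with `f` Schwartz is essentially bounded.
All integrability and membership in `L²` comes from this.

Existence. By stationarity the second moment measure of the process is invariant under diagonal
translations. Unfolding the integral over pairs of points (`integral_secondMoment_eq_cube`) and
using Plancherel, the second moment of `N^w_f` equals the autocorrelation applied to `𝓕 (|𝓕 f|²)`
(`integral_norm_weightedCount_sq`). Hence the autocorrelation composed with `𝓕` is nonnegative on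
the functions `|ψ|²`. It is also bounded uniformly over the translates of `ψ`, since a translation
in frequency only multiplies `𝓕⁻ ψ` by a phase. `exists_measure_of_nonneg_on_normSq` then yields the
measure `σ`, and the same identity says that `ψ ↦ N^w_{𝓕⁻ ψ}` is isometric on Schwartz functions,
which are dense in `L²(σ)`.

Density. For an algebra of bounded functions, the measurable sets whose indicators are `L²`-limits
of elements form a `σ`-algebra that contains the null sets and, by Weierstrass approximation, makes
the real measurable elements of the algebra measurable (`exists_mem_eLpNorm_sub_le`). It remains to
see that the weighted counts generate the `σ`-algebra modulo null sets. If a cube carries at most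
one point `(x, i)` and `f` is supported in it, then `N_f = w_i f(x)` and `N_{f²} = w_i f(x)²`, so
`N_f² / N_{f²}` is `w_i` when `f(x) ≠ 0`, and `0` otherwise. As the weights are distinct and
nonzero, this ratio reveals the colour (`measure_prod_singleton_eq`). Countably many small cubes
then recover the whole configuration. -/

noncomputable section

namespace ColouredPointProcess

open scoped NNReal Topology ContDiff
open Module

/-! ### A polynomial weight and measures with uniformly bounded mass on balls -/

section Decay

variable {E : Type*} [NormedAddCommGroup E] [NormedSpace ℝ E]

/-- The integrable weight `(1 + ‖x‖) ^ (-(dim E + 1))`. -/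
def decay (x : E) : ℝ := (1 + ‖x‖) ^ (-((finrank ℝ E + 1 : ℕ) : ℝ))

theorem decay_pos (x : E) : 0 < decay x := by unfold decay; positivity

theorem continuous_decay : Continuous (decay : E → ℝ) := by
  unfold decay
  refine Continuous.rpow_const (by fun_prop) fun x => Or.inl (by positivity)

/-- A Peetre inequality: `1 + ‖y‖ ≤ (1 + ‖x‖) (1 + ‖x - y‖)`. Moving the argument by a bounded
distance costs only a bounded factor. -/
theorem decay_le_mul_decay (x y : E) :
    decay x ≤ (1 + ‖x - y‖) ^ (finrank ℝ E + 1) * decay y := by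
  unfold decay
  rw [Real.rpow_neg (by positivity), Real.rpow_neg (by positivity), Real.rpow_natCast,
    Real.rpow_natCast, ← div_eq_mul_inv, le_div_iff₀ (by positivity), inv_mul_le_iff₀ (by positivity),
    ← mul_pow]
  gcongr
  have h : ‖y‖ ≤ ‖x‖ + ‖x - y‖ := by
    have := norm_sub_le x (x - y); simpa using this
  nlinarith [norm_nonneg x, norm_nonneg (x - y)]

/-- Schwartz functions are bounded by multiples of `decay`, continuously. -/
theorem norm_schwartz_le_mul_decay (f : 𝓢(E, ℂ)) (x : E) :
    ‖f x‖ ≤ (2 ^ (finrank ℝ E + 1) * (Finset.Iic (finrank ℝ E + 1, 0)).sup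
      (schwartzSeminormFamily ℂ E ℂ) f) * decay x := by
  unfold decay
  rw [Real.rpow_neg (by positivity), Real.rpow_natCast, ← div_eq_mul_inv,
    le_div_iff₀ (by positivity), mul_comm]
  have := SchwartzMap.one_add_le_sup_seminorm_apply (𝕜 := ℂ) (m := (finrank ℝ E + 1, 0))
    (k := finrank ℝ E + 1) (n := 0) le_rfl le_rfl f x
  rwa [norm_iteratedFDeriv_zero] at this

variable [FiniteDimensional ℝ E] [MeasurableSpace E] [BorelSpace E]

theorem integrable_decay (μ : Measure E) [μ.IsAddHaarMeasure] :
    Integrable (decay : E → ℝ) μ :=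
  integrable_one_add_norm (by push_cast; linarith)

/-- A measure whose mass on balls of a fixed radius is bounded integrates all the
translates of `decay`, with a uniform bound. -/
theorem exists_lintegral_decay_le {δ : ℝ} (hδ : 0 < δ) (c : ℝ≥0) :
    ∃ C : ℝ≥0, ∀ (ρ : Measure E) [SFinite ρ], (∀ a, ρ (Metric.ball a δ) ≤ c) →
      ∀ a, ∫⁻ x, ENNReal.ofReal (decay (x - a)) ∂ρ ≤ C := by
  let v : Measure E := Measure.addHaar
  have hv0 : v (Metric.ball 0 δ) ≠ 0 := (Metric.measure_ball_pos v 0 hδ).ne'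
  have hvt : v (Metric.ball 0 δ) ≠ ⊤ := measure_ball_lt_top.ne
  set K : ℝ≥0∞ := ENNReal.ofReal ((1 + δ) ^ (finrank ℝ E + 1)) with hK
  have hint : ∫⁻ y, ENNReal.ofReal (decay y) ∂v < ⊤ := (integrable_decay v).lintegral_lt_top
  refine ⟨((v (Metric.ball 0 δ))⁻¹ * (K * (c * ∫⁻ y, ENNReal.ofReal (decay y) ∂v))).toNNReal, ?_⟩
  intro ρ _ hρ a
  rw [ENNReal.coe_toNNReal (by
    refine ENNReal.mul_ne_top (ENNReal.inv_ne_top.2 hv0) (ENNReal.mul_ne_top (by simp [hK]) ?_)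
    exact ENNReal.mul_ne_top (by simp) hint.ne)]
  -- Each point of `ρ` is smeared over its `δ`-ball by Haar measure, at the cost of the factor `K`.
  -- Tonelli then exchanges the Haar mass of balls for their `ρ`-mass, which is at most `c`.
  rw [← ENNReal.div_eq_inv_mul, ENNReal.le_div_iff_mul_le (Or.inl hv0) (Or.inl hvt)]
  have hm : Measurable fun x : E => ENNReal.ofReal (decay (x - a)) :=
    (continuous_decay.measurable.comp (measurable_id.sub_const a)).ennreal_ofReal
  have hS : MeasurableSet {z : E × E | dist z.2 z.1 < δ} :=
    (isOpen_lt (by fun_prop) (by fun_prop)).measurableSet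
  calc (∫⁻ x, ENNReal.ofReal (decay (x - a)) ∂ρ) * v (Metric.ball 0 δ)
      = ∫⁻ x, ENNReal.ofReal (decay (x - a)) * v (Metric.ball x δ) ∂ρ := by
        rw [← lintegral_mul_const _ hm]
        simp_rw [Measure.addHaar_ball_center v _ δ]
    _ = ∫⁻ x, ∫⁻ y, (Metric.ball x δ).indicator (fun _ => ENNReal.ofReal (decay (x - a))) y ∂v ∂ρ := by
        refine lintegral_congr fun x => ?_
        rw [lintegral_indicator Metric.isOpen_ball.measurableSet]
        simp
    _ ≤ ∫⁻ x, ∫⁻ y, (Metric.ball x δ).indicator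
          (fun y => K * ENNReal.ofReal (decay (y - a))) y ∂v ∂ρ := by
        refine lintegral_mono fun x => lintegral_mono fun y => ?_
        by_cases hy : y ∈ Metric.ball x δ
        · rw [Set.indicator_of_mem hy, Set.indicator_of_mem hy, hK, ← ENNReal.ofReal_mul (by positivity)]
          refine ENNReal.ofReal_le_ofReal ((decay_le_mul_decay _ (y - a)).trans ?_)
          have : ‖x - a - (y - a)‖ ≤ δ := by
            rw [sub_sub_sub_cancel_right, ← dist_eq_norm, dist_comm]; exact (Metric.mem_ball.1 hy).le
          have := (decay_pos (y - a)).le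
          gcongr
        · simp [Set.indicator_of_notMem hy]
    _ = ∫⁻ y, ∫⁻ x, (Metric.ball x δ).indicator
          (fun y => K * ENNReal.ofReal (decay (y - a))) y ∂ρ ∂v := by
        refine lintegral_lintegral_swap ?_
        have : Measurable (Set.indicator {z : E × E | dist z.2 z.1 < δ}
            fun z => K * ENNReal.ofReal (decay (z.2 - a))) :=
          ((hm.comp measurable_snd).const_mul K).indicator hS
        exact this.aemeasurable
    _ = ∫⁻ y, K * ENNReal.ofReal (decay (y - a)) * ρ (Metric.ball y δ) ∂v := by
        refine lintegral_congr fun y => ?_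
        rw [← setLIntegral_const, ← lintegral_indicator Metric.isOpen_ball.measurableSet]
        refine lintegral_congr fun x => ?_
        simp only [Set.indicator, Metric.mem_ball, dist_comm]
    _ ≤ ∫⁻ y, K * ENNReal.ofReal (decay (y - a)) * c ∂v := by
        gcongr with y
        exact hρ y
    _ = K * (c * ∫⁻ y, ENNReal.ofReal (decay (y - a)) ∂v) := by
        rw [lintegral_mul_const _ (hm.const_mul K), lintegral_const_mul _ hm]
        ring
    _ = _ := by rw [lintegral_sub_right_eq_self fun y => ENNReal.ofReal (decay y)]

theorem hasTemperateGrowth_of_measure_ball_le {ρ : Measure E} [SFinite ρ] {δ : ℝ} (hδ : 0 < δ)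
    {c : ℝ≥0} (hρ : ∀ a, ρ (Metric.ball a δ) ≤ c) : ρ.HasTemperateGrowth := by
  obtain ⟨C, hC⟩ := exists_lintegral_decay_le (E := E) hδ c
  refine ⟨finrank ℝ E + 1, continuous_decay.aestronglyMeasurable, ?_⟩
  change HasFiniteIntegral (decay : E → ℝ) ρ
  rw [hasFiniteIntegral_iff_ofReal (ae_of_all _ fun x => (decay_pos x).le)]
  have := hC ρ hρ 0
  simp only [sub_zero] at this
  exact this.trans_lt (by simp)

end Decay

end ColouredPointProcess

end

noncomputable section

namespace ColouredPointProcess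

open scoped NNReal Topology ContDiff
open Module

/-! ### Density of compactly supported functions in the Schwartz space -/

section Cutoff

variable {E : Type*} [NormedAddCommGroup E] [InnerProductSpace ℝ E] [FiniteDimensional ℝ E]

/-- Smooth compactly supported functions are dense in the Schwartz space. -/
theorem exists_seq_hasCompactSupport_tendsto (φ : 𝓢(E, ℂ)) :
    ∃ u : ℕ → 𝓢(E, ℂ), (∀ n, HasCompactSupport (u n)) ∧ Tendsto u atTop (𝓝 φ) := by
  let χ : ContDiffBump (0 : E) := ⟨1, 2, one_pos, one_lt_two⟩
  have hχ : ContDiff ℝ ∞ χ := χ.contDiff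
  -- The cutoff `χ ∘ L n` equals `1` on the ball of radius `n + 1`. Since `‖L n‖ ≤ 1`, its
  -- derivatives are bounded uniformly in `n`.
  let L : ℕ → E →L[ℝ] E := fun n => ((n : ℝ) + 1)⁻¹ • ContinuousLinearMap.id ℝ E
  have hLn : ∀ n, ‖L n‖ ≤ 1 := by
    intro n
    refine (norm_smul_le (((n : ℝ) + 1)⁻¹) (ContinuousLinearMap.id ℝ E)).trans ?_
    have h1 := ContinuousLinearMap.norm_id_le (𝕜 := ℝ) (E := E)
    rw [Real.norm_of_nonneg (by positivity)]
    refine mul_le_one₀ ?_ (norm_nonneg _) h1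
    exact inv_le_one_of_one_le₀ (by linarith [(Nat.cast_nonneg n : (0:ℝ) ≤ n)])
  have hL0 : ∀ n (x : E), L n x = ((n : ℝ) + 1)⁻¹ • x := fun n x => rfl
  have hcs : ∀ n, HasCompactSupport fun x => χ (L n x) := by
    intro n
    refine χ.hasCompactSupport.comp_homeomorph
      (Homeomorph.smulOfNeZero (((n : ℝ) + 1)⁻¹) (by positivity))
  have hcd : ∀ n, ContDiff ℝ ∞ fun x => χ (L n x) := fun n => hχ.comp (L n).contDiff
  have htg : ∀ n, Function.HasTemperateGrowth fun x => χ (L n x) := fun n =>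
    (hcs n).hasTemperateGrowth (hcd n)
  have hval : ∀ n x, SchwartzMap.smulLeftCLM ℂ (fun x => χ (L n x)) φ x = χ (L n x) • φ x :=
    fun n x => SchwartzMap.smulLeftCLM_apply_apply (htg n) φ x
  refine ⟨fun n => SchwartzMap.smulLeftCLM ℂ (fun x => χ (L n x)) φ, fun n => ?_, ?_⟩
  · have : (SchwartzMap.smulLeftCLM ℂ (fun x => χ (L n x)) φ : E → ℂ)
        = (fun x => χ (L n x)) • (φ : E → ℂ) := funext (hval n)
    rw [this]
    exact (hcs n).smul_right
  rw [(schwartz_withSeminorms ℝ E ℂ).tendsto_nhds]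
  rintro ⟨k, m⟩ ε hε
  -- bounds for the derivatives of the cutoff
  have hB : ∀ j : ℕ, ∃ B : ℝ, 0 ≤ B ∧ ∀ n x, ‖iteratedFDeriv ℝ j (fun x => χ (L n x) - 1) x‖ ≤ B := by
    intro j
    let χS : 𝓢(E, ℝ) := χ.hasCompactSupport.toSchwartzMap hχ
    -- The `+ 1` accounts for the subtracted constant, which contributes only to the derivative of
    -- order `0`.
    refine ⟨SchwartzMap.seminorm ℝ 0 j χS + 1, by positivity, fun n x => ?_⟩
    have h1 : (fun x => χ (L n x) - 1) = (fun y => χ y - 1) ∘ L n := rfl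
    have hsm : ContDiff ℝ ∞ fun y => χ y - 1 := hχ.sub contDiff_const
    rw [h1, (L n).iteratedFDeriv_comp_right hsm x (by exact_mod_cast le_top)]
    refine (ContinuousMultilinearMap.norm_compContinuousLinearMap_le _ _).trans ?_
    have h2 : ‖iteratedFDeriv ℝ j (fun y => χ y - 1) (L n x)‖ ≤ SchwartzMap.seminorm ℝ 0 j χS + 1 := by
      have h3 : iteratedFDeriv ℝ j (fun y => χ y - 1) (L n x) =
          iteratedFDeriv ℝ j χ (L n x) - iteratedFDeriv ℝ j (fun _ : E => (1 : ℝ)) (L n x) :=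
        iteratedFDeriv_sub_apply (hχ.contDiffAt.of_le (by exact_mod_cast le_top)) contDiffAt_const
      rw [h3]
      refine (norm_sub_le _ _).trans (add_le_add (χS.norm_iteratedFDeriv_le_seminorm ℝ j _) ?_)
      rcases Nat.eq_zero_or_pos j with rfl | hj
      · simp
      · rw [iteratedFDeriv_const_of_ne hj.ne']; simp
    calc _ ≤ (SchwartzMap.seminorm ℝ 0 j χS + 1) * 1 := by
          refine mul_le_mul h2 ?_ (by positivity) (by positivity)
          exact Finset.prod_le_one (fun _ _ => norm_nonneg _) fun _ _ => hLn n
      _ = _ := mul_one _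
  choose B hB0 hB using hB
  -- The seminorms have order `k + 1`: where the difference does not vanish, `‖x‖ ≥ n + 1`, and the
  -- spare power of `‖x‖` yields the factor `(n + 1)⁻¹`.
  let M : ℝ := ∑ i ∈ Finset.range (m + 1), (m.choose i : ℝ) * B i * SchwartzMap.seminorm ℝ (k + 1) (m - i) φ
  have hM0 : 0 ≤ M := Finset.sum_nonneg fun i _ => by have := hB0 i; positivity
  have hbound : ∀ n : ℕ, SchwartzMap.seminorm ℝ k m
      (SchwartzMap.smulLeftCLM ℂ (fun x => χ (L n x)) φ - φ) ≤ M * ((n : ℝ) + 1)⁻¹ := by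
    intro n
    refine SchwartzMap.seminorm_le_bound ℝ k m _ (by positivity) fun x => ?_
    have hfun : ((SchwartzMap.smulLeftCLM ℂ (fun x => χ (L n x)) φ - φ : 𝓢(E, ℂ)) : E → ℂ)
        = fun x => (χ (L n x) - 1) • φ x := by
      funext x
      rw [sub_apply, hval, sub_smul, one_smul]
    rw [hfun]
    by_cases hx : ‖x‖ < (n : ℝ) + 1
    · have hev : (fun x => (χ (L n x) - 1) • φ x) =ᶠ[𝓝 x] fun _ => 0 := by
        have ho : {y : E | ‖y‖ < (n : ℝ) + 1} ∈ 𝓝 x :=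
          (isOpen_lt continuous_norm continuous_const).mem_nhds hx
        filter_upwards [ho] with y hy
        have : χ (L n y) = 1 := by
          refine χ.one_of_mem_closedBall ?_
          rw [mem_closedBall_zero_iff, hL0, norm_smul, Real.norm_of_nonneg (by positivity),
            inv_mul_le_iff₀ (by positivity)]
          simpa [χ] using hy.le
        rw [this]; simp
      rw [(hev.iteratedFDeriv ℝ m).eq_of_nhds]
      have : iteratedFDeriv ℝ m (fun _ : E => (0 : ℂ)) x = 0 := by
        rw [iteratedFDeriv_fun_zero]; rfl
      rw [this]
      simp only [norm_zero, mul_zero]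
      positivity
    · push Not at hx
      have hle := norm_iteratedFDeriv_smul_le (𝕜 := ℝ) (f := fun x => χ (L n x) - 1) (g := φ)
        ((hcd n).sub contDiff_const) (φ.smooth ⊤) x (n := m)
        (by exact_mod_cast le_top)
      calc ‖x‖ ^ k * ‖iteratedFDeriv ℝ m (fun x => (χ (L n x) - 1) • φ x) x‖
          ≤ ‖x‖ ^ k * ∑ i ∈ Finset.range (m + 1), (m.choose i : ℝ) *
              ‖iteratedFDeriv ℝ i (fun x => χ (L n x) - 1) x‖ * ‖iteratedFDeriv ℝ (m - i) φ x‖ := by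
            gcongr
        _ ≤ M * ((n : ℝ) + 1)⁻¹ := by
            rw [Finset.mul_sum, Finset.sum_mul]
            refine Finset.sum_le_sum fun i _ => ?_
            have hk : ‖x‖ ^ k * ‖iteratedFDeriv ℝ (m - i) φ x‖ ≤
                SchwartzMap.seminorm ℝ (k + 1) (m - i) φ * ((n : ℝ) + 1)⁻¹ := by
              rw [← div_eq_mul_inv, le_div_iff₀ (by positivity)]
              calc _ ≤ ‖x‖ ^ k * ‖iteratedFDeriv ℝ (m - i) φ x‖ * ‖x‖ := by gcongr
                _ = ‖x‖ ^ (k + 1) * ‖iteratedFDeriv ℝ (m - i) φ x‖ := by ring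
                _ ≤ _ := φ.le_seminorm ℝ _ _ _
            calc _ = (m.choose i : ℝ) * ‖iteratedFDeriv ℝ i (fun x => χ (L n x) - 1) x‖ *
                  (‖x‖ ^ k * ‖iteratedFDeriv ℝ (m - i) φ x‖) := by ring
              _ ≤ (m.choose i : ℝ) * B i *
                  (SchwartzMap.seminorm ℝ (k + 1) (m - i) φ * ((n : ℝ) + 1)⁻¹) := by
                have := hB0 i
                gcongr
                exact hB i n x
              _ = _ := by ring
  have hlim : Tendsto (fun n : ℕ => M * ((n : ℝ) + 1)⁻¹) atTop (𝓝 0) := by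
    have := (tendsto_one_div_add_atTop_nhds_zero_nat (𝕜 := ℝ)).const_mul M
    simpa using this
  filter_upwards [hlim.eventually (gt_mem_nhds hε)] with n hn
  exact (hbound n).trans_lt hn

theorem continuousLinearMap_ext_of_hasCompactSupport {S T : 𝓢(E, ℂ) →L[ℂ] ℂ}
    (h : ∀ φ : 𝓢(E, ℂ), HasCompactSupport φ → S φ = T φ) : S = T := by
  ext φ
  obtain ⟨u, hu, hlim⟩ := exists_seq_hasCompactSupport_tendsto φ
  refine tendsto_nhds_unique ((S.continuous.tendsto φ).comp hlim) ?_
  refine ((T.continuous.tendsto φ).comp hlim).congr fun n => (h _ (hu n)).symm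

end Cutoff

end ColouredPointProcess

end

noncomputable section

namespace ColouredPointProcess

open scoped NNReal Topology ContDiff ComplexOrder CompactlySupported
open Module

/-! ### From positivity on squares to a measure -/

section BochnerSchwartz

variable {E : Type*} [NormedAddCommGroup E] [InnerProductSpace ℝ E]

/-- A smooth compactly supported real function, as a complex Schwartz function. -/
def realTestFunction {f : E → ℝ} (hc : HasCompactSupport f) (hs : ContDiff ℝ ∞ f) : 𝓢(E, ℂ) :=
  (hc.comp_left (g := ((↑) : ℝ → ℂ)) Complex.ofReal_zero).toSchwartzMap
    (Complex.ofRealCLM.contDiff.comp hs)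

theorem realTestFunction_apply {f : E → ℝ} (hc : HasCompactSupport f) (hs : ContDiff ℝ ∞ f)
    (x : E) : realTestFunction hc hs x = f x := rfl

/-- The subspace of smooth functions in `C_c(E, ℝ)`. -/
def smoothCompactlySupported (E : Type*) [NormedAddCommGroup E] [InnerProductSpace ℝ E] :
    Submodule ℝ C_c(E, ℝ) where
  carrier := {f | ContDiff ℝ ∞ f}
  add_mem' {f g} hf hg := show ContDiff ℝ ∞ fun x => f x + g x from ContDiff.add hf hg
  zero_mem' := show ContDiff ℝ ∞ fun _ => (0 : ℝ) from contDiff_const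
  smul_mem' c f hf := by
    have hf' : ContDiff ℝ ∞ (f : E → ℝ) := hf
    exact contDiff_const.smul hf'

theorem mem_smoothCompactlySupported {f : C_c(E, ℝ)} :
    f ∈ smoothCompactlySupported E ↔ ContDiff ℝ ∞ f := Iff.rfl

variable [FiniteDimensional ℝ E]

/-- A bump function equal to `1` near a given bounded set. -/
theorem exists_bump_of_isCompact {K : Set E} (hK : IsCompact K) :
    ∃ χ : ContDiffBump (0 : E), ∀ x ∈ K, χ x = 1 := by
  obtain ⟨R, hR⟩ := hK.isBounded.subset_closedBall (0 : E)
  refine ⟨⟨max R 1, max R 1 + 1, by positivity, by linarith⟩, fun x hx => ?_⟩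
  refine ContDiffBump.one_of_mem_closedBall _ ?_
  exact Metric.closedBall_subset_closedBall (le_max_left _ _) (hR hx)

/-- A functional that is nonnegative on squared absolute values of Schwartz functions is
nonnegative on nonnegative test functions. -/
theorem nonneg_of_nonneg_on_normSq {T : 𝓢(E, ℂ) →L[ℂ] ℂ}
    (hT : ∀ φ ψ : 𝓢(E, ℂ), (∀ x, φ x = ((‖ψ x‖ ^ 2 : ℝ) : ℂ)) → 0 ≤ T φ)
    {f : E → ℝ} (hc : HasCompactSupport f) (hs : ContDiff ℝ ∞ f) (hf : ∀ x, 0 ≤ f x) :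
    0 ≤ T (realTestFunction hc hs) := by
  obtain ⟨χ, hχ⟩ := exists_bump_of_isCompact hc.isCompact
  have hχ2s : ContDiff ℝ ∞ fun x => χ x ^ 2 := χ.contDiff.pow 2
  have hχ2c : HasCompactSupport fun x => χ x ^ 2 :=
    χ.hasCompactSupport.comp_left (g := fun t => t ^ 2) (by simp)
  have hχT : 0 ≤ T (realTestFunction hχ2c hχ2s) :=
    hT _ (realTestFunction χ.hasCompactSupport χ.contDiff) fun x => by
      simp only [realTestFunction_apply, Complex.norm_real, Real.norm_eq_abs, sq_abs]
  -- The square root of `f` need not be smooth where `f` vanishes. Adding `ε χ²`, with `χ = 1` on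
  -- the support of `f`, makes the root smooth: the sum is positive on that support, and off it the
  -- root is `√ε χ`. Then `ε` tends to `0`.
  have key : ∀ ε : ℝ, 0 < ε → 0 ≤ T (realTestFunction hc hs) + ε * T (realTestFunction hχ2c hχ2s) := by
    intro ε hε
    let g : E → ℝ := fun x => √(f x + ε * χ x ^ 2)
    have hg0 : ∀ x, 0 ≤ f x + ε * χ x ^ 2 := fun x => by have := hf x; positivity
    have hgs : ContDiff ℝ ∞ g := by
      rw [contDiff_iff_contDiffAt]
      intro x
      by_cases hx : x ∈ tsupport f
      · refine ContDiffAt.sqrt (hs.add (contDiff_const.mul hχ2s)).contDiffAt ?_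
        have := hf x
        rw [hχ x hx]; positivity
      · have h1 : g =ᶠ[𝓝 x] fun y => √ε * χ y := by
          filter_upwards [notMem_tsupport_iff_eventuallyEq.1 hx] with y hy
          simp only [g, hy, Pi.zero_apply, zero_add]
          rw [Real.sqrt_mul hε.le, Real.sqrt_sq χ.nonneg]
        exact ((contDiff_const.mul χ.contDiff).contDiffAt).congr_of_eventuallyEq h1
    have hgc : HasCompactSupport g := by
      refine HasCompactSupport.intro (hc.isCompact.union χ.hasCompactSupport.isCompact) fun x hx => ?_
      simp only [Set.mem_union, not_or] at hx
      simp [g, image_eq_zero_of_notMem_tsupport hx.1, image_eq_zero_of_notMem_tsupport hx.2]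
    have := hT (realTestFunction hc hs + (ε : ℂ) • realTestFunction hχ2c hχ2s)
      (realTestFunction hgc hgs) fun x => by
        rw [add_apply, smul_apply, realTestFunction_apply, realTestFunction_apply,
          realTestFunction_apply, Complex.norm_real, Real.norm_eq_abs, sq_abs, Real.sq_sqrt (hg0 x)]
        push_cast; rfl
    simpa using this
  have him := Complex.le_def.1 (key 1 one_pos)
  have him' := Complex.le_def.1 hχT
  simp only [Complex.zero_re, Complex.zero_im, Complex.add_im, Complex.re_ofReal_mul,
    Complex.im_ofReal_mul, Complex.add_re] at him him'
  refine Complex.le_def.2 ⟨?_, ?_⟩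
  · refine le_of_forall_pos_le_add fun δ hδ => ?_
    have h := (Complex.le_def.1 (key (δ / ((T (realTestFunction hχ2c hχ2s)).re + 1))
      (div_pos hδ (by linarith [him'.1])))).1
    simp only [Complex.zero_re, Complex.add_re, Complex.re_ofReal_mul] at h ⊢
    refine h.trans ?_
    gcongr
    rw [div_mul_eq_mul_div, div_le_iff₀ (by linarith [him'.1])]
    nlinarith
  · simp only [Complex.zero_im]
    linarith [him.2, him'.2]

variable [MeasurableSpace E] [BorelSpace E]

/-- A positive functional on test functions is given by a measure. -/
theorem exists_measure_of_nonneg_on_testFunctions {T : 𝓢(E, ℂ) →L[ℂ] ℂ}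
    (hT : ∀ (f : E → ℝ) (hc : HasCompactSupport f) (hs : ContDiff ℝ ∞ f), (∀ x, 0 ≤ f x) →
      0 ≤ T (realTestFunction hc hs)) :
    ∃ σ : Measure E, IsFiniteMeasureOnCompacts σ ∧
      ∀ (f : E → ℝ) (hc : HasCompactSupport f) (hs : ContDiff ℝ ∞ f),
        ((∫ x, f x ∂σ : ℝ) : ℂ) = T (realTestFunction hc hs) := by
  let F : smoothCompactlySupported E →ₗ[ℝ] ℝ :=
    { toFun := fun f => (T (realTestFunction f.1.hasCompactSupport (mem_smoothCompactlySupported.1 f.2))).re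
      map_add' := fun f g => by
        rw [← Complex.add_re, ← map_add]
        congr 2
        ext x
        exact Complex.ofReal_add (f.1 x) (g.1 x)
      map_smul' := fun c f => by
        have : realTestFunction (c • f).1.hasCompactSupport
              (mem_smoothCompactlySupported.1 (c • f).2) =
            (c : ℂ) • realTestFunction f.1.hasCompactSupport (mem_smoothCompactlySupported.1 f.2) := by
          ext x
          exact Complex.ofReal_mul c (f.1 x)
        rw [this, map_smul, smul_eq_mul, Complex.re_ofReal_mul]
        rfl }
  let s : PointedCone ℝ C_c(E, ℝ) :=
    { carrier := {f | ∀ x, 0 ≤ f x}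
      add_mem' := fun hf hg x => add_nonneg (hf x) (hg x)
      zero_mem' := fun x => le_rfl
      smul_mem' := fun c f hf x => mul_nonneg c.2 (hf x) }
  -- M. Riesz extension from smooth functions to `C_c(E, ℝ)`. The cofinality condition holds because
  -- a multiple of a smooth bump dominates `-f`.
  obtain ⟨Λ, hΛ, hΛ0⟩ := riesz_extension s ⟨smoothCompactlySupported E, F⟩
    (fun f hf => (Complex.le_def.1 (hT f.1 f.1.hasCompactSupport (mem_smoothCompactlySupported.1 f.2) hf)).1)
    (fun f => by
      obtain ⟨χ, hχ⟩ := exists_bump_of_isCompact f.hasCompactSupport.isCompact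
      obtain ⟨M, hM⟩ := f.hasCompactSupport.exists_bound_of_continuous f.continuous
      have hMc : HasCompactSupport fun x => M * χ x := χ.hasCompactSupport.mul_left
      refine ⟨⟨⟨⟨fun x => M * χ x, continuous_const.mul χ.continuous⟩, hMc⟩,
        mem_smoothCompactlySupported.2 (contDiff_const.mul χ.contDiff)⟩, fun x => ?_⟩
      change 0 ≤ M * χ x + f x
      by_cases hx : x ∈ tsupport f
      · rw [hχ x hx]
        have := hM x
        rw [Real.norm_eq_abs] at this
        linarith [neg_abs_le (f x)]
      · rw [image_eq_zero_of_notMem_tsupport hx, add_zero]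
        exact mul_nonneg ((norm_nonneg _).trans (hM 0)) χ.nonneg)
  let Λ' : C_c(E, ℝ) →ₚ[ℝ] ℝ := PositiveLinearMap.mk₀ Λ fun f hf => hΛ0 f hf
  -- `f` is the difference of the nonnegative test functions `M χ + f` and `M χ`, on both of which
  -- `T` is real.
  have hre : ∀ (f : E → ℝ) (hc : HasCompactSupport f) (hs : ContDiff ℝ ∞ f),
      (T (realTestFunction hc hs)).im = 0 := by
    intro f hc hs
    obtain ⟨χ, hχ⟩ := exists_bump_of_isCompact hc.isCompact
    obtain ⟨M, hM⟩ := hc.exists_bound_of_continuous hs.continuous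
    have hMc : HasCompactSupport fun x => M * χ x := χ.hasCompactSupport.mul_left
    have hMs : ContDiff ℝ ∞ fun x => M * χ x := contDiff_const.mul χ.contDiff
    have hM0 : 0 ≤ M := (norm_nonneg _).trans (hM 0)
    have h1 := (Complex.le_def.1 (hT _ hMc hMs fun x => mul_nonneg hM0 χ.nonneg)).2
    have h2 := (Complex.le_def.1 (hT _ (hMc.add hc) (hMs.add hs) fun x => by
      change 0 ≤ M * χ x + f x
      by_cases hx : x ∈ tsupport f
      · rw [hχ x hx]
        have := hM x
        rw [Real.norm_eq_abs] at this
        linarith [neg_abs_le (f x)]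
      · rw [image_eq_zero_of_notMem_tsupport hx, add_zero]
        exact mul_nonneg hM0 χ.nonneg)).2
    have h3 : realTestFunction (hMc.add hc) (hMs.add hs) =
        realTestFunction hMc hMs + realTestFunction hc hs := by
      ext x
      simp [realTestFunction_apply]
    rw [h3, map_add, Complex.add_im] at h2
    simp only [Complex.zero_im] at h1 h2
    linarith
  refine ⟨RealRMK.rieszMeasure Λ', inferInstance, fun f hc hs => ?_⟩
  have h1 := RealRMK.integral_rieszMeasure Λ' ⟨⟨f, hs.continuous⟩, hc⟩
  have h2 := hΛ ⟨⟨⟨f, hs.continuous⟩, hc⟩, mem_smoothCompactlySupported.2 hs⟩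
  refine Complex.ext ?_ ?_
  · rw [Complex.ofReal_re]
    exact h1.trans h2
  · rw [Complex.ofReal_im, hre]

/-- A form of the **Bochner–Schwartz theorem**: a tempered distribution of positive type
that is uniformly bounded on the translates of the squares of Schwartz functions is
a (translation bounded) measure. -/
theorem exists_measure_of_nonneg_on_normSq {T : 𝓢(E, ℂ) →L[ℂ] ℂ}
    (hT : ∀ φ ψ : 𝓢(E, ℂ), (∀ x, φ x = ((‖ψ x‖ ^ 2 : ℝ) : ℂ)) → 0 ≤ T φ)
    (hbdd : ∀ ψ : 𝓢(E, ℂ), ∃ C : ℝ, ∀ (a : E) (φ : 𝓢(E, ℂ)),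
      (∀ x, φ x = ((‖ψ (x - a)‖ ^ 2 : ℝ) : ℂ)) → (T φ).re ≤ C) :
    ∃ (σ : Measure E) (_ : σ.HasTemperateGrowth), IsFiniteMeasureOnCompacts σ ∧
      ∀ φ : 𝓢(E, ℂ), ∫ x, φ x ∂σ = T φ := by
  obtain ⟨σ, hfin, hσ⟩ := exists_measure_of_nonneg_on_testFunctions
    fun f hc hs hf => nonneg_of_nonneg_on_normSq hT hc hs hf
  -- The translate of `χ²` by `a` is `1` on the ball about `a`, and `hbdd` bounds its integral
  -- independently of `a`.
  have hball : ∃ c : ℝ≥0, ∀ a, σ (Metric.ball a 1) ≤ c := by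
    let χ : ContDiffBump (0 : E) := ⟨1, 2, one_pos, one_lt_two⟩
    obtain ⟨C, hC⟩ := hbdd (realTestFunction χ.hasCompactSupport χ.contDiff)
    refine ⟨C.toNNReal, fun a => ?_⟩
    let f : E → ℝ := fun x => χ (x - a) ^ 2
    have hs : ContDiff ℝ ∞ f := (χ.contDiff.comp (contDiff_id.sub contDiff_const)).pow 2
    have hc : HasCompactSupport f := by
      have h1 : HasCompactSupport fun x => χ (x - a) :=
        χ.hasCompactSupport.comp_homeomorph (Homeomorph.subRight a)
      exact h1.comp_left (g := fun t => t ^ 2) (by simp)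
    have hint : ∫ x, f x ∂σ ≤ C := by
      have h1 := hC a (realTestFunction hc hs) fun x => by
        simp only [realTestFunction_apply, Complex.norm_real, Real.norm_eq_abs, sq_abs, f]
      rwa [← hσ f hc hs, Complex.ofReal_re] at h1
    have hfi : Integrable f σ := hs.continuous.integrable_of_hasCompactSupport hc
    calc σ (Metric.ball a 1) = ∫⁻ x in Metric.ball a 1, 1 ∂σ := by simp
      _ ≤ ∫⁻ x in Metric.ball a 1, ENNReal.ofReal (f x) ∂σ := by
        refine setLIntegral_mono' Metric.isOpen_ball.measurableSet fun x hx => ?_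
        have : χ (x - a) = 1 := χ.one_of_mem_closedBall (by
          rw [mem_closedBall_zero_iff, ← dist_eq_norm]; exact (Metric.mem_ball.1 hx).le)
        simp [f, this]
      _ ≤ ∫⁻ x, ENNReal.ofReal (f x) ∂σ := setLIntegral_le_lintegral _ _
      _ = ENNReal.ofReal (∫ x, f x ∂σ) :=
        (ofReal_integral_eq_lintegral_ofReal hfi (ae_of_all _ fun x => sq_nonneg _)).symm
      _ ≤ _ := ENNReal.ofReal_le_ofReal hint
  obtain ⟨c, hc⟩ := hball
  have htg : σ.HasTemperateGrowth := hasTemperateGrowth_of_measure_ball_le one_pos hc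
  refine ⟨σ, htg, hfin, fun φ => ?_⟩
  have hext : SchwartzMap.integralCLM ℂ σ = T := by
    refine continuousLinearMap_ext_of_hasCompactSupport fun φ hφ => ?_
    have hres : ContDiff ℝ ∞ fun x => (φ x).re := Complex.reCLM.contDiff.comp (φ.smooth ⊤)
    have hims : ContDiff ℝ ∞ fun x => (φ x).im := Complex.imCLM.contDiff.comp (φ.smooth ⊤)
    have hrec : HasCompactSupport fun x => (φ x).re := hφ.comp_left (g := Complex.re) rfl
    have himc : HasCompactSupport fun x => (φ x).im := hφ.comp_left (g := Complex.im) rfl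
    have hdec : φ = realTestFunction hrec hres + Complex.I • realTestFunction himc hims := by
      ext x
      rw [add_apply, smul_apply, realTestFunction_apply, realTestFunction_apply, smul_eq_mul,
        mul_comm, Complex.re_add_im]
    rw [hdec, map_add, map_add, map_smul, map_smul, ← hσ, ← hσ, SchwartzMap.integralCLM_apply,
      SchwartzMap.integralCLM_apply]
    simp only [realTestFunction_apply, integral_complex_ofReal]
  rw [← hext, SchwartzMap.integralCLM_apply]

end BochnerSchwartz

end ColouredPointProcess

end

noncomputable section

namespace ColouredPointProcess

open scoped NNReal Topology ContDiff
open Module ProbabilityTheory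

/-! ### Point measures as a kernel, and uniform bounds for weighted counts -/

section PointMeasures

variable {d m : ℕ}

instance (ν : PointMeasure d m) : IsFiniteMeasureOnCompacts ν.1 where
  lt_top_of_isCompact K hK := by
    obtain ⟨n, hn⟩ := ν.2 K hK.isClosed.measurableSet (by rwa [hK.isClosed.closure_eq])
    rw [hn]
    exact ENNReal.natCast_lt_top n

theorem measurable_pointMeasure_val :
    Measurable (Subtype.val : PointMeasure d m → Measure (Space d × Fin m)) :=
  measurable_subtype_coe

/-- The kernel sending a point measure to itself. -/
def pointKernel (d m : ℕ) : Kernel (PointMeasure d m) (Space d × Fin m) :=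
  ⟨Subtype.val, measurable_pointMeasure_val⟩

theorem pointKernel_apply (ν : PointMeasure d m) : pointKernel d m ν = ν.1 := rfl

theorem measurable_vadd (t : Space d) : Measurable fun ν : PointMeasure d m => t +ᵥ ν :=
  ((Measure.measurable_map _ (shift m t).continuous.measurable).comp
    measurable_pointMeasure_val).subtype_mk

theorem vadd_val (t : Space d) (ν : PointMeasure d m) : (t +ᵥ ν).1 = ν.1.map (shift m t) := rfl

/-- The mass of `D` is finite for each `ν` but not uniformly so. On the set of `ν` with `ν D = n` it
is bounded by `n`, and these sets partition the space. -/
theorem isSFiniteKernel_restrict_pointKernel {D : Set (Space d × Fin m)} (hD : MeasurableSet D)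
    (hc : IsCompact (closure D)) : IsSFiniteKernel ((pointKernel d m).restrict hD) := by
  have hmeas : ∀ n : ℕ, MeasurableSet {ν : PointMeasure d m | ν.1 D = n} := fun n =>
    ((Measure.measurable_coe hD).comp measurable_pointMeasure_val) (measurableSet_singleton _)
  classical
  let κ : ℕ → Kernel (PointMeasure d m) (Space d × Fin m) := fun n =>
    Kernel.piecewise (hmeas n) ((pointKernel d m).restrict hD) 0
  have hκ : ∀ n, IsFiniteKernel (κ n) := fun n => ⟨n, ENNReal.natCast_lt_top n, fun ν => by
    simp only [κ, Kernel.piecewise_apply, Set.mem_ofPred_eq]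
    split_ifs with h
    · rw [Kernel.restrict_apply, Measure.restrict_apply_univ, pointKernel_apply, h]
    · simp⟩
  have hsum : (pointKernel d m).restrict hD = Kernel.sum κ := by
    ext ν s hs
    rw [Kernel.sum_apply' _ _ hs]
    obtain ⟨n, hn⟩ := ν.2 D hD hc
    rw [tsum_eq_single n]
    · simp [κ, Kernel.piecewise_apply, hn]
    · intro k hk
      simp only [κ, Kernel.piecewise_apply, Set.mem_ofPred_eq, hn]
      rw [if_neg (by exact_mod_cast hk.symm)]
      simp
  rw [hsum]
  infer_instance

instance : IsSFiniteKernel (pointKernel d m) := by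
  let B : ℕ → Set (Space d × Fin m) := fun n => Metric.closedBall 0 n ×ˢ Set.univ
  have hB : ∀ n, IsCompact (B n) := fun n => (isCompact_closedBall _ _).prod isCompact_univ
  have hBm : ∀ n, MeasurableSet (B n) := fun n => (hB n).isClosed.measurableSet
  have hD : ∀ n, MeasurableSet (disjointed B n) := fun n => MeasurableSet.disjointed hBm n
  have hDc : ∀ n, IsCompact (closure (disjointed B n)) := fun n =>
    (hB n).of_isClosed_subset isClosed_closure
      (closure_minimal (disjointed_subset B n) (hB n).isClosed)
  have hU : ⋃ n, disjointed B n = Set.univ := by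
    rw [iUnion_disjointed, Set.eq_univ_iff_forall]
    intro p
    obtain ⟨n, hn⟩ := exists_nat_ge ‖p.1‖
    exact Set.mem_iUnion.2 ⟨n, by simpa [B] using hn⟩
  have hsum : pointKernel d m = Kernel.sum fun n => (pointKernel d m).restrict (hD n) := by
    ext ν s hs
    rw [Kernel.sum_apply' _ _ hs]
    conv_lhs => rw [← Measure.restrict_univ (μ := pointKernel d m ν), ← hU,
      Measure.restrict_iUnion (disjoint_disjointed B) hD, Measure.sum_apply _ hs]
    simp only [Kernel.restrict_apply]
  have := fun n => isSFiniteKernel_restrict_pointKernel (hD n) (hDc n)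
  rw [hsum]
  infer_instance

/-- A point measure integrates all the translates of `decay`, with bound `C`. -/
def DecayBounded (C : ℝ≥0) (ν : PointMeasure d m) : Prop :=
  ∀ a, ∫⁻ p, ENNReal.ofReal (decay (p.1 - a)) ∂ν.1 ≤ C

theorem ball_subset_cube (a : Space d) (r : ℝ) : Metric.ball a (r / 2) ⊆ cube a r := by
  intro x hx i
  have h1 := PiLp.norm_apply_le (p := 2) (x - a) i
  rw [PiLp.sub_apply, Real.norm_eq_abs] at h1
  exact h1.trans_lt (by rw [← dist_eq_norm]; exact Metric.mem_ball.1 hx)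

/-- Forgetting colours leaves a measure with mass at most `1` on each ball of radius `r / 2`, as
that ball lies in the cube of edge length `r`. -/
theorem exists_decayBounded {μ : Measure (PointMeasure d m)} (hμ : IsUniformlyDiscrete μ) :
    ∃ C : ℝ≥0, ∀ᵐ ν ∂μ, DecayBounded C ν := by
  obtain ⟨r, hr, hν⟩ := hμ
  obtain ⟨C, hC⟩ := exists_lintegral_decay_le (E := Space d) (half_pos hr) 1
  refine ⟨C, hν.mono fun ν hν a => ?_⟩
  have h := hC (ν.1.map Prod.fst) (fun b => ?_) a
  · rwa [lintegral_map ?_ measurable_fst] at h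
    exact (continuous_decay.measurable.comp (measurable_id.sub_const a)).ennreal_ofReal
  · rw [Measure.map_apply measurable_fst Metric.isOpen_ball.measurableSet]
    refine (measure_mono fun p hp => ?_).trans (hν b)
    exact ⟨ball_subset_cube b r hp, trivial⟩

/-- An upper bound for the absolute values of the weights. -/
def weightBound (w : Fin m → ℝ) : ℝ := ∑ i, |w i|

theorem weightBound_nonneg (w : Fin m → ℝ) : 0 ≤ weightBound w :=
  Finset.sum_nonneg fun _ _ => abs_nonneg _

theorem norm_weight_le (w : Fin m → ℝ) (i : Fin m) : ‖(w i : ℂ)‖ ≤ weightBound w := by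
  rw [Complex.norm_real, Real.norm_eq_abs]
  exact Finset.single_le_sum (f := fun i => |w i|) (fun _ _ => abs_nonneg _) (Finset.mem_univ i)

theorem measurable_weight (w : Fin m → ℝ) :
    Measurable fun p : Space d × Fin m => (w p.2 : ℂ) :=
  (measurable_of_finite fun i : Fin m => (w i : ℂ)).comp measurable_snd

/-- The decay constant of a Schwartz function. -/
def decayConst {E : Type*} [NormedAddCommGroup E] [NormedSpace ℝ E] (f : 𝓢(E, ℂ)) : ℝ :=
  2 ^ (finrank ℝ E + 1) * (Finset.Iic (finrank ℝ E + 1, 0)).sup (schwartzSeminormFamily ℂ E ℂ) f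

theorem decayConst_nonneg {E : Type*} [NormedAddCommGroup E] [NormedSpace ℝ E] (f : 𝓢(E, ℂ)) :
    0 ≤ decayConst f := by unfold decayConst; positivity

/-- The centre `a` is free and the bound does not depend on it, so that the estimate applies
uniformly to `x ↦ f (x - p)` for the points `p` of the process. -/
theorem lintegral_enorm_weight_mul_le (w : Fin m → ℝ) {C : ℝ≥0} {ν : PointMeasure d m}
    (hν : DecayBounded C ν) {g : Space d → ℂ} {S : ℝ} (a : Space d)
    (hg : ∀ x, ‖g x‖ ≤ S * decay (x - a)) :
    ∫⁻ p, ‖(w p.2 : ℂ) * g p.1‖ₑ ∂ν.1 ≤ ENNReal.ofReal (weightBound w * S) * C := by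
  have hS : 0 ≤ S := by
    have := (norm_nonneg _).trans (hg 0)
    exact nonneg_of_mul_nonneg_left this (decay_pos _)
  calc ∫⁻ p, ‖(w p.2 : ℂ) * g p.1‖ₑ ∂ν.1
      ≤ ∫⁻ p, ENNReal.ofReal (weightBound w * S) * ENNReal.ofReal (decay (p.1 - a)) ∂ν.1 := by
        refine lintegral_mono fun p => ?_
        rw [← ENNReal.ofReal_mul (mul_nonneg (weightBound_nonneg w) hS), ← ofReal_norm, norm_mul,
          mul_assoc]
        refine ENNReal.ofReal_le_ofReal (mul_le_mul (norm_weight_le w _) (hg _) (norm_nonneg _)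
          (weightBound_nonneg w))
    _ = ENNReal.ofReal (weightBound w * S) * ∫⁻ p, ENNReal.ofReal (decay (p.1 - a)) ∂ν.1 := by
        refine lintegral_const_mul _ ?_
        exact (continuous_decay.measurable.comp (measurable_fst.sub_const a)).ennreal_ofReal
    _ ≤ _ := by gcongr; exact hν a

theorem integrable_weight_mul (w : Fin m → ℝ) {C : ℝ≥0} {ν : PointMeasure d m}
    (hν : DecayBounded C ν) {g : Space d → ℂ} {S : ℝ} (a : Space d)
    (hg : ∀ x, ‖g x‖ ≤ S * decay (x - a)) (hm : Measurable g) :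
    Integrable (fun p : Space d × Fin m => (w p.2 : ℂ) * g p.1) ν.1 :=
  ⟨((measurable_weight w).mul (hm.comp measurable_fst)).aestronglyMeasurable,
    (lintegral_enorm_weight_mul_le w hν a hg).trans_lt (by finiteness)⟩

theorem norm_integral_weight_mul_le (w : Fin m → ℝ) {C : ℝ≥0} {ν : PointMeasure d m}
    (hν : DecayBounded C ν) {g : Space d → ℂ} {S : ℝ} (a : Space d)
    (hg : ∀ x, ‖g x‖ ≤ S * decay (x - a)) :
    ‖∫ p, (w p.2 : ℂ) * g p.1 ∂ν.1‖ ≤ weightBound w * S * C := by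
  have hS : 0 ≤ S := by
    have := (norm_nonneg _).trans (hg 0)
    exact nonneg_of_mul_nonneg_left this (decay_pos _)
  have h := (enorm_integral_le_lintegral_enorm _).trans (lintegral_enorm_weight_mul_le w hν a hg)
  have h0 : 0 ≤ weightBound w * S := mul_nonneg (weightBound_nonneg w) hS
  rw [← ofReal_norm, ← ENNReal.ofReal_coe_nnreal, ← ENNReal.ofReal_mul h0] at h
  exact (ENNReal.ofReal_le_ofReal_iff (by positivity)).1 h

theorem norm_schwartz_le (f : 𝓢(Space d, ℂ)) (x : Space d) :
    ‖f x‖ ≤ decayConst f * decay (x - 0) := by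
  rw [sub_zero]; exact norm_schwartz_le_mul_decay f x

theorem integrable_weightedCount (w : Fin m → ℝ) {C : ℝ≥0} {ν : PointMeasure d m}
    (hν : DecayBounded C ν) (f : 𝓢(Space d, ℂ)) :
    Integrable (fun p : Space d × Fin m => (w p.2 : ℂ) * f p.1) ν.1 :=
  integrable_weight_mul w hν 0 (norm_schwartz_le f) f.continuous.measurable

theorem norm_weightedCount_le (w : Fin m → ℝ) {C : ℝ≥0} {ν : PointMeasure d m}
    (hν : DecayBounded C ν) (f : 𝓢(Space d, ℂ)) :
    ‖weightedCount w f ν‖ ≤ weightBound w * decayConst f * C :=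
  norm_integral_weight_mul_le w hν 0 (norm_schwartz_le f)

theorem stronglyMeasurable_weightedCount (w : Fin m → ℝ) {f : Space d → ℂ} (hf : Measurable f) :
    StronglyMeasurable (weightedCount w f : PointMeasure d m → ℂ) :=
  StronglyMeasurable.integral_kernel (κ := pointKernel d m)
    ((measurable_weight w).mul (hf.comp measurable_fst)).stronglyMeasurable

end PointMeasures

end ColouredPointProcess

end

noncomputable section

namespace ColouredPointProcess

open scoped NNReal Topology ContDiff ComplexConjugate
open Module ProbabilityTheory

/-! ### Correlations of translates through Plancherel -/

section Correlation

variable {V : Type*} [NormedAddCommGroup V] [InnerProductSpace ℝ V] [FiniteDimensional ℝ V]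
  [MeasurableSpace V] [BorelSpace V]

theorem fourier_compSubConst (h : 𝓢(V, ℂ)) (a k : V) :
    𝓕 (SchwartzMap.compSubConstCLM ℂ a h) k = Real.fourierChar (-inner ℝ a k) • 𝓕 h k := by
  have h1 := congr_fun (VectorFourier.fourierIntegral_comp_add_right Real.fourierChar
    (volume : Measure V) (innerₗ V) h (-a)) k
  rw [map_neg, LinearMap.neg_apply, innerₗ_apply_apply] at h1
  rw [SchwartzMap.fourier_coe, SchwartzMap.fourier_coe, Real.fourier_eq, Real.fourier_eq]
  refine Eq.trans ?_ h1
  refine integral_congr_ae (ae_of_all _ fun x => ?_)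
  simp [sub_eq_add_neg]

/-- The correlation of two translates of a Schwartz function is the Fourier transform of the
squared absolute value of its Fourier transform. -/
theorem integral_mul_conj_translate {h φ : 𝓢(V, ℂ)}
    (hφ : ∀ k, φ k = ((‖𝓕 h k‖ ^ 2 : ℝ) : ℂ)) (x y : V) :
    ∫ t, h (t + x) * conj (h (t + y)) = 𝓕 φ (y - x) := by
  -- Plancherel. The inner product is conjugate-linear in its first argument, so the translate by
  -- `y`, which gets conjugated, comes first.
  have h1 := SchwartzMap.integral_inner_fourier_fourier
    (SchwartzMap.compSubConstCLM ℂ (-y) h) (SchwartzMap.compSubConstCLM ℂ (-x) h)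
  simp only [fourier_compSubConst, SchwartzMap.compSubConstCLM_apply, sub_neg_eq_add,
    RCLike.inner_apply] at h1
  have h5 : 𝓕 φ (y - x) = ∫ k, Real.fourierChar (-inner ℝ k (y - x)) • φ k := by
    rw [SchwartzMap.fourier_coe, Real.fourier_eq]
  rw [← h1, h5]
  refine integral_congr_ae (ae_of_all _ fun k => ?_)
  simp only [hφ, Circle.smul_def, smul_eq_mul, map_mul, inner_neg_left, neg_neg]
  have h2 : conj ((Real.fourierChar (inner ℝ y k) : Circle) : ℂ) =
      ((Real.fourierChar (-inner ℝ y k) : Circle) : ℂ) := by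
    rw [AddChar.map_neg_eq_inv, Circle.coe_inv_eq_conj]
  have h3 : ((Real.fourierChar (-inner ℝ k (y - x)) : Circle) : ℂ) =
      ((Real.fourierChar (inner ℝ x k) : Circle) : ℂ) * ((Real.fourierChar (-inner ℝ y k) : Circle) : ℂ) := by
    rw [← Circle.coe_mul, ← AddChar.map_add_eq_mul, inner_sub_right, real_inner_comm x k,
      real_inner_comm y k]
    ring_nf
  rw [h2, h3]
  have h4 : ((‖𝓕 h k‖ ^ 2 : ℝ) : ℂ) = 𝓕 h k * conj (𝓕 h k) := by
    rw [Complex.mul_conj, Complex.normSq_eq_norm_sq]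
  rw [h4]
  ring

end Correlation

/-! ### The unit cube -/

section Cube

variable {d : ℕ}

theorem isOpen_cube (a : Space d) (R : ℝ) : IsOpen (cube a R) := by
  have : cube a R = ⋂ i, {x : Space d | |x i - a i| < R / 2} := by
    ext x; simp [cube]
  rw [this]
  exact isOpen_iInter_of_finite fun i => isOpen_lt (by fun_prop) continuous_const

theorem volume_cube_one (a : Space d) : volume (cube a 1) = 1 := by
  have h : cube a 1 = WithLp.ofLp ⁻¹' (Set.univ.pi fun i => Set.Ioo (a i - 1 / 2) (a i + 1 / 2)) := by
    ext x
    simp only [cube, Set.mem_ofPred_eq, Set.mem_preimage, Set.mem_pi, Set.mem_univ, true_imp_iff,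
      Set.mem_Ioo, abs_lt]
    exact forall_congr' fun i => ⟨fun h => ⟨by linarith, by linarith⟩, fun h => ⟨by linarith, by linarith⟩⟩
  rw [h, (PiLp.volume_preserving_ofLp (Fin d)).measure_preimage
    (MeasurableSet.univ_pi fun _ => measurableSet_Ioo).nullMeasurableSet, volume_pi_pi]
  simp [Real.volume_Ioo]
  norm_num

theorem norm_le_of_mem_cube {x : Space d} (hx : x ∈ cube 0 1) : ‖x‖ ≤ d + 1 := by
  have h1 : ‖x‖ ^ 2 ≤ d := by
    rw [EuclideanSpace.norm_sq_eq]
    calc ∑ i, ‖x i‖ ^ 2 ≤ ∑ _i : Fin d, (1 : ℝ) := by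
          refine Finset.sum_le_sum fun i _ => ?_
          have := hx i
          rw [PiLp.zero_apply, sub_zero] at this
          rw [Real.norm_eq_abs]
          nlinarith [abs_nonneg (x i)]
      _ = d := by simp
  nlinarith [norm_nonneg x]

/-- The indicator function of the unit cube about the origin. -/
def cubeIndicator (d : ℕ) (x : Space d) : ℂ := (cube (0 : Space d) 1).indicator 1 x

theorem measurable_cubeIndicator : Measurable (cubeIndicator d) :=
  measurable_one.indicator (isOpen_cube 0 1).measurableSet

/-- The indicator is not Schwartz, but this puts it under the same estimates. The constant comes
from `1 + ‖x‖ ≤ 2 + d` on the cube. -/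
theorem norm_cubeIndicator_le (x : Space d) :
    ‖cubeIndicator d x‖ ≤ (2 + d) ^ (d + 1) * decay (x - 0) := by
  rw [sub_zero]
  by_cases hx : x ∈ cube 0 1
  · rw [cubeIndicator, Set.indicator_of_mem hx, Pi.one_apply, norm_one, decay,
      Real.rpow_neg (by positivity), Real.rpow_natCast, finrank_euclideanSpace_fin,
      ← div_eq_mul_inv, one_le_div (by positivity)]
    refine pow_le_pow_left₀ (by positivity) ?_ _
    linarith [norm_le_of_mem_cube hx]
  · rw [cubeIndicator, Set.indicator_of_notMem hx, norm_zero]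
    have := (decay_pos x).le
    positivity

theorem integral_cubeIndicator_sub (x : Space d) :
    ∫ t, cubeIndicator d (x - t) = 1 := by
  rw [integral_sub_left_eq_self (cubeIndicator d) volume x]
  unfold cubeIndicator
  rw [integral_indicator (isOpen_cube 0 1).measurableSet]
  simp [Measure.real, volume_cube_one]

theorem integrable_cubeIndicator_sub (x : Space d) :
    Integrable fun t => cubeIndicator d (x - t) := by
  refine Integrable.comp_sub_left ?_ x
  refine (integrable_indicator_iff (isOpen_cube 0 1).measurableSet).2 ?_
  exact integrableOn_const (by rw [volume_cube_one]; exact ENNReal.one_ne_top)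

theorem integral_norm_cubeIndicator_sub (x : Space d) :
    ∫ t, ‖cubeIndicator d (x - t)‖ = 1 := by
  have h : ∀ y, ((‖cubeIndicator d y‖ : ℝ) : ℂ) = cubeIndicator d y := by
    intro y
    unfold cubeIndicator
    by_cases hy : y ∈ cube 0 1
    · rw [Set.indicator_of_mem hy, Pi.one_apply, norm_one, Complex.ofReal_one]
    · rw [Set.indicator_of_notMem hy, norm_zero, Complex.ofReal_zero]
  have := (integral_congr_ae (ae_of_all volume fun t => h (x - t))).trans
    (integral_cubeIndicator_sub x)
  rw [integral_complex_ofReal] at this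
  exact_mod_cast this

end Cube

end ColouredPointProcess

end

noncomputable section

namespace ColouredPointProcess

open scoped NNReal Topology ContDiff ComplexConjugate
open Module ProbabilityTheory

/-! ### The second moment measure and the autocorrelation -/

section SecondMoment

variable {d m : ℕ}

/-- The second moment measure of a coloured point process. -/
def secondMoment (μ : Measure (PointMeasure d m)) :
    Measure ((Space d × Fin m) × (Space d × Fin m)) :=
  μ.bind (pointKernel d m ×ₖ pointKernel d m)

instance (μ : Measure (PointMeasure d m)) [IsProbabilityMeasure μ] : SFinite (secondMoment μ) := by
  unfold secondMoment; infer_instance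

theorem lintegral_secondMoment (μ : Measure (PointMeasure d m))
    {G : (Space d × Fin m) × (Space d × Fin m) → ℝ≥0∞} (hG : Measurable G) :
    ∫⁻ z, G z ∂secondMoment μ = ∫⁻ ν, ∫⁻ p, ∫⁻ q, G (p, q) ∂ν.1 ∂ν.1 ∂μ := by
  unfold secondMoment
  rw [Measure.lintegral_bind (Kernel.aemeasurable _) hG.aemeasurable]
  refine lintegral_congr fun ν => ?_
  rw [Kernel.prod_apply, lintegral_prod _ hG.aemeasurable]
  rfl

theorem lintegral_enorm_secondMoment_le {μ : Measure (PointMeasure d m)} [IsProbabilityMeasure μ]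
    {G : (Space d × Fin m) × (Space d × Fin m) → ℂ} (hG : Measurable G) {B : ℝ≥0∞}
    (hB : ∀ᵐ ν ∂μ, ∫⁻ p, ∫⁻ q, ‖G (p, q)‖ₑ ∂ν.1 ∂ν.1 ≤ B) :
    ∫⁻ z, ‖G z‖ₑ ∂secondMoment μ ≤ B := by
  rw [lintegral_secondMoment μ hG.enorm]
  exact (lintegral_mono_ae hB).trans (by simp)

theorem integral_secondMoment {μ : Measure (PointMeasure d m)} [IsProbabilityMeasure μ]
    {G : (Space d × Fin m) × (Space d × Fin m) → ℂ} (hG : Integrable G (secondMoment μ)) :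
    ∫ z, G z ∂secondMoment μ = ∫ ν, ∫ p, ∫ q, G (p, q) ∂ν.1 ∂ν.1 ∂μ := by
  have h := Measure.ae_integrable_of_integrable_comp hG
  unfold secondMoment at hG ⊢
  rw [Measure.comp_eq_comp_const_apply] at hG ⊢
  rw [Kernel.integral_comp hG, Kernel.const_apply]
  refine integral_congr_ae (h.mono fun ν hν => ?_)
  rw [Kernel.prod_apply] at hν
  simp only [Kernel.prod_apply]
  exact integral_prod _ hν

theorem secondMoment_map_shift (μ : Measure (PointMeasure d m))
    [VAddInvariantMeasure (Space d) (PointMeasure d m) μ] (t : Space d) :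
    (secondMoment μ).map (Prod.map (shift m t) (shift m t)) = secondMoment μ := by
  have hs : Measurable (shift m t) := (shift m t).continuous.measurable
  have hss : Measurable (Prod.map (shift m t) (shift m t)) := hs.prodMap hs
  ext S hS
  have hμ : μ.map (fun ν => t +ᵥ ν) = μ := by
    ext A hA
    rw [Measure.map_apply (measurable_vadd t) hA]
    exact VAddInvariantMeasure.measure_preimage_vadd t hA
  rw [Measure.map_apply hss hS, secondMoment, Measure.bind_apply (hss hS) (Kernel.aemeasurable _),
    Measure.bind_apply hS (Kernel.aemeasurable _)]
  conv_rhs => rw [← hμ, lintegral_map (Kernel.measurable_coe _ hS) (measurable_vadd t)]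
  refine lintegral_congr fun ν => ?_
  rw [Kernel.prod_apply, Kernel.prod_apply, pointKernel_apply, pointKernel_apply, vadd_val,
    Measure.map_prod_map _ _ hs hs, Measure.map_apply hss hS]

/-- **Mass transport**: the total integral of a function of pairs of points is the integral over
the pairs with first point in the unit cube of the integral over the diagonal translates. -/
theorem integral_secondMoment_eq_cube {μ : Measure (PointMeasure d m)} [IsProbabilityMeasure μ]
    [VAddInvariantMeasure (Space d) (PointMeasure d m) μ]
    {Φ : (Space d × Fin m) × (Space d × Fin m) → ℂ} (hΦ : Integrable Φ (secondMoment μ))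
    (hΦm : Measurable Φ) :
    ∫ z, Φ z ∂secondMoment μ =
      ∫ z, cubeIndicator d z.1.1 * (∫ t, Φ (shift m t z.1, shift m t z.2)) ∂secondMoment μ := by
  -- Integrating `Ψ` over the translation `t` gives back `Φ`, because the cube has volume `1`. After
  -- the measure-preserving change `(t, z) ↦ (t, t + z)` the indicator no longer depends on `t`, and
  -- the other side appears.
  let Ψ : Space d × ((Space d × Fin m) × (Space d × Fin m)) → ℂ :=
    fun y => cubeIndicator d (y.2.1.1 - y.1) * Φ y.2
  have hΨm : Measurable Ψ :=
    (measurable_cubeIndicator.comp (by fun_prop)).mul (hΦm.comp measurable_snd)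
  have hΨ : Integrable Ψ (volume.prod (secondMoment μ)) := by
    rw [integrable_prod_iff' hΨm.aestronglyMeasurable]
    refine ⟨ae_of_all _ fun z => (integrable_cubeIndicator_sub z.1.1).mul_const (Φ z), ?_⟩
    refine hΦ.norm.congr (ae_of_all _ fun z => ?_)
    simp only [Ψ, norm_mul]
    rw [integral_mul_const, integral_norm_cubeIndicator_sub, one_mul]
  have hshift : Measurable fun y : Space d × ((Space d × Fin m) × (Space d × Fin m)) =>
      ((shift m y.1 y.2.1, shift m y.1 y.2.2) : (Space d × Fin m) × (Space d × Fin m)) := by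
    change Measurable fun y : Space d × ((Space d × Fin m) × (Space d × Fin m)) =>
      (((y.1 + y.2.1.1, y.2.1.2), (y.1 + y.2.2.1, y.2.2.2)) :
        (Space d × Fin m) × (Space d × Fin m))
    fun_prop
  have hpres : MeasurePreserving (fun y : Space d × ((Space d × Fin m) × (Space d × Fin m)) =>
      (y.1, ((shift m y.1 y.2.1, shift m y.1 y.2.2) : (Space d × Fin m) × (Space d × Fin m))))
      (volume.prod (secondMoment μ)) (volume.prod (secondMoment μ)) :=
    (MeasurePreserving.id volume).skew_product
      (g := fun (t : Space d) (z : (Space d × Fin m) × (Space d × Fin m)) => ((shift m t z.1, shift m t z.2) :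
        (Space d × Fin m) × (Space d × Fin m))) hshift
      (ae_of_all _ fun t => secondMoment_map_shift μ t)
  have h1 : ∫ y, Ψ y ∂(volume.prod (secondMoment μ)) = ∫ z, Φ z ∂secondMoment μ := by
    rw [integral_prod_symm _ hΨ]
    refine integral_congr_ae (ae_of_all _ fun z => ?_)
    simp only [Ψ]
    rw [integral_mul_const, integral_cubeIndicator_sub, one_mul]
  have hint := hpres.integrable_comp_of_integrable hΨ
  rw [Function.comp_def] at hint
  rw [← h1, ← hpres.map_eq, integral_map hpres.measurable.aemeasurable
    (hpres.map_eq.symm ▸ hΨm.aestronglyMeasurable), integral_prod_symm _ hint]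
  refine integral_congr_ae (ae_of_all _ fun z => ?_)
  simp only [Ψ]
  rw [← integral_const_mul]
  refine integral_congr_ae (ae_of_all _ fun t => ?_)
  have : (shift m t z.1).1 - t = z.1.1 := by
    change t + z.1.1 - t = z.1.1
    abel
  simp only [this]

theorem measurable_pairWeight (w : Fin m → ℝ) {g : Space d → ℂ} (hg : Measurable g)
    {l : Space d → ℂ} (hl : Measurable l) :
    Measurable fun z : (Space d × Fin m) × (Space d × Fin m) =>
      (w z.1.2 : ℂ) * l z.1.1 * ((w z.2.2 : ℂ) * g (z.2.1 - z.1.1)) :=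
  (((measurable_weight w).comp measurable_fst).mul (hl.comp (by fun_prop))).mul
    (((measurable_weight w).comp measurable_snd).mul (hg.comp (by fun_prop)))

/-- The integrand of the weighted autocorrelation with respect to the second moment measure. -/
def autocorrelationKernel (w : Fin m → ℝ) (f : Space d → ℂ)
    (z : (Space d × Fin m) × (Space d × Fin m)) : ℂ :=
  (w z.1.2 : ℂ) * cubeIndicator d z.1.1 * ((w z.2.2 : ℂ) * f (z.2.1 - z.1.1))

theorem measurable_autocorrelationKernel (w : Fin m → ℝ) (f : 𝓢(Space d, ℂ)) :
    Measurable (autocorrelationKernel w f) :=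
  measurable_pairWeight w f.continuous.measurable measurable_cubeIndicator

/-- The bound is linear in `decayConst f`, a multiple of a Schwartz seminorm. It thus serves both
for integrability and for the continuity of the autocorrelation as a tempered distribution. -/
theorem lintegral_autocorrelationKernel_le {μ : Measure (PointMeasure d m)}
    [IsProbabilityMeasure μ] {C : ℝ≥0} (hC : ∀ᵐ ν ∂μ, DecayBounded C ν) (w : Fin m → ℝ)
    (f : 𝓢(Space d, ℂ)) :
    ∫⁻ z, ‖autocorrelationKernel w f z‖ₑ ∂secondMoment μ ≤
      ENNReal.ofReal (weightBound w * (2 + d) ^ (d + 1)) * C *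
        (ENNReal.ofReal (weightBound w * decayConst f) * C) := by
  refine lintegral_enorm_secondMoment_le (measurable_autocorrelationKernel w f)
    (hC.mono fun ν hν => ?_)
  calc ∫⁻ p, ∫⁻ q, ‖autocorrelationKernel w f (p, q)‖ₑ ∂ν.1 ∂ν.1
      ≤ ∫⁻ p, ‖(w p.2 : ℂ) * cubeIndicator d p.1‖ₑ *
          (ENNReal.ofReal (weightBound w * decayConst f) * C) ∂ν.1 := by
        refine lintegral_mono fun p => ?_
        simp only [autocorrelationKernel]
        simp_rw [enorm_mul ((w p.2 : ℂ) * cubeIndicator d p.1)]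
        have hm : Measurable fun q : Space d × Fin m => ‖(w q.2 : ℂ) * f (q.1 - p.1)‖ₑ :=
          ((measurable_weight w).mul (f.continuous.measurable.comp
            (measurable_fst.sub_const p.1))).enorm
        refine (lintegral_const_mul _ hm).trans_le (mul_le_mul_right ?_ _)
        exact lintegral_enorm_weight_mul_le w hν (g := fun x => f (x - p.1)) p.1
          fun x => norm_schwartz_le_mul_decay f _
    _ = (∫⁻ p, ‖(w p.2 : ℂ) * cubeIndicator d p.1‖ₑ ∂ν.1) *
          (ENNReal.ofReal (weightBound w * decayConst f) * C) :=
        lintegral_mul_const _ (((measurable_weight w).mul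
          (measurable_cubeIndicator.comp measurable_fst)).enorm)
    _ ≤ _ := by
        gcongr
        exact lintegral_enorm_weight_mul_le w hν 0 norm_cubeIndicator_le

theorem integrable_autocorrelationKernel {μ : Measure (PointMeasure d m)}
    [IsProbabilityMeasure μ] {C : ℝ≥0} (hC : ∀ᵐ ν ∂μ, DecayBounded C ν) (w : Fin m → ℝ)
    (f : 𝓢(Space d, ℂ)) : Integrable (autocorrelationKernel w f) (secondMoment μ) :=
  ⟨(measurable_autocorrelationKernel w f).aestronglyMeasurable,
    (lintegral_autocorrelationKernel_le hC w f).trans_lt (by finiteness)⟩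

theorem weightedCount_vadd (w : Fin m → ℝ) (f : Space d → ℂ) (t : Space d)
    (ν : PointMeasure d m) :
    weightedCount w f (t +ᵥ ν) = ∫ q, (w q.2 : ℂ) * f (t + q.1) ∂ν.1 :=
  (shift m t).measurableEmbedding.integral_map _

theorem weightedAutocorrelation_eq {μ : Measure (PointMeasure d m)}
    [IsProbabilityMeasure μ] {C : ℝ≥0} (hC : ∀ᵐ ν ∂μ, DecayBounded C ν) (w : Fin m → ℝ)
    (f : 𝓢(Space d, ℂ)) :
    weightedAutocorrelation μ w f = ∫ z, autocorrelationKernel w f z ∂secondMoment μ := by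
  rw [integral_secondMoment (integrable_autocorrelationKernel hC w f)]
  unfold weightedAutocorrelation weightedPalm
  refine integral_congr_ae (ae_of_all _ fun ν => ?_)
  have hS : MeasurableSet (cube (0 : Space d) 1 ×ˢ (Set.univ : Set (Fin m))) :=
    (isOpen_cube 0 1).measurableSet.prod MeasurableSet.univ
  simp only
  rw [← integral_indicator hS]
  refine integral_congr_ae (ae_of_all _ fun p => ?_)
  simp only [autocorrelationKernel, integral_const_mul]
  by_cases hp : p.1 ∈ cube (0 : Space d) 1
  · rw [Set.indicator_of_mem (show p ∈ _ ×ˢ _ from ⟨hp, Set.mem_univ _⟩), weightedCount_vadd,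
      cubeIndicator, Set.indicator_of_mem hp, Pi.one_apply, mul_one]
    simp only [neg_add_eq_sub]
  · rw [Set.indicator_of_notMem (fun h => hp h.1), cubeIndicator, Set.indicator_of_notMem hp]
    simp

/-- The weighted autocorrelation as a tempered distribution. -/
def autocorrelationCLM {μ : Measure (PointMeasure d m)} [IsProbabilityMeasure μ] {C : ℝ≥0}
    (hC : ∀ᵐ ν ∂μ, DecayBounded C ν) (w : Fin m → ℝ) : 𝓢(Space d, ℂ) →L[ℂ] ℂ :=
  SchwartzMap.mkCLMtoNormedSpace (fun f => ∫ z, autocorrelationKernel w f z ∂secondMoment μ)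
    (fun f g => by
      rw [← integral_add (integrable_autocorrelationKernel hC w f)
        (integrable_autocorrelationKernel hC w g)]
      refine integral_congr_ae (ae_of_all _ fun z => ?_)
      simp only [autocorrelationKernel, add_apply]
      ring)
    (fun c f => by
      rw [RingHom.id_apply, smul_eq_mul, ← integral_const_mul]
      refine integral_congr_ae (ae_of_all _ fun z => ?_)
      simp only [autocorrelationKernel, smul_apply, smul_eq_mul]
      ring) <| by
    have hw := weightBound_nonneg w
    refine ⟨Finset.Iic (finrank ℝ (Space d) + 1, 0), weightBound w * (2 + d) ^ (d + 1) * C *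
      (weightBound w * C * 2 ^ (finrank ℝ (Space d) + 1)), by positivity, fun f => ?_⟩
    have h := (enorm_integral_le_lintegral_enorm _).trans
      (lintegral_autocorrelationKernel_le hC w f)
    have hf := decayConst_nonneg f
    rw [← ofReal_norm, ← ENNReal.ofReal_coe_nnreal, ← ENNReal.ofReal_mul (by positivity),
      ← ENNReal.ofReal_mul (by positivity), ← ENNReal.ofReal_mul (by positivity),
      ENNReal.ofReal_le_ofReal_iff (by positivity)] at h
    refine h.trans (le_of_eq ?_)
    unfold decayConst
    ring

theorem autocorrelationCLM_apply {μ : Measure (PointMeasure d m)} [IsProbabilityMeasure μ]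
    {C : ℝ≥0} (hC : ∀ᵐ ν ∂μ, DecayBounded C ν) (w : Fin m → ℝ) (f : 𝓢(Space d, ℂ)) :
    autocorrelationCLM hC w f = weightedAutocorrelation μ w f :=
  (weightedAutocorrelation_eq hC w f).symm

/-- The second moment of the weighted count is the autocorrelation applied to
the Fourier transform of the squared absolute value of the Fourier transform. -/
theorem integral_norm_weightedCount_sq {μ : Measure (PointMeasure d m)} [IsProbabilityMeasure μ]
    [VAddInvariantMeasure (Space d) (PointMeasure d m) μ]
    {C : ℝ≥0} (hC : ∀ᵐ ν ∂μ, DecayBounded C ν) (w : Fin m → ℝ) {h φ : 𝓢(Space d, ℂ)}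
    (hφ : ∀ k, φ k = ((‖𝓕 h k‖ ^ 2 : ℝ) : ℂ)) :
    ((∫ ν, ‖weightedCount w h ν‖ ^ 2 ∂μ : ℝ) : ℂ) =
      weightedAutocorrelation μ w (𝓕 φ : 𝓢(Space d, ℂ)) := by
  let Φ : (Space d × Fin m) × (Space d × Fin m) → ℂ := fun z =>
    ((w z.1.2 : ℂ) * h z.1.1) * conj ((w z.2.2 : ℂ) * h z.2.1)
  have hwm : Measurable fun p : Space d × Fin m => (w p.2 : ℂ) * h p.1 :=
    (measurable_weight w).mul (h.continuous.measurable.comp measurable_fst)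
  have hΦm : Measurable Φ :=
    (hwm.comp measurable_fst).mul (Complex.continuous_conj.measurable.comp
      (hwm.comp measurable_snd))
  have hfin : ENNReal.ofReal (weightBound w * decayConst h) * C < ⊤ :=
    ENNReal.mul_lt_top ENNReal.ofReal_lt_top ENNReal.coe_lt_top
  have hΦ : Integrable Φ (secondMoment μ) := by
    refine ⟨hΦm.aestronglyMeasurable, (lintegral_enorm_secondMoment_le hΦm
      (B := ENNReal.ofReal (weightBound w * decayConst h) * C *
        (ENNReal.ofReal (weightBound w * decayConst h) * C))
      (hC.mono fun ν hν => ?_)).trans_lt (ENNReal.mul_lt_top hfin hfin)⟩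
    have h1 := lintegral_enorm_weight_mul_le w hν 0 (norm_schwartz_le h)
    have h2 : ∀ z : ℂ, ‖conj z‖ₑ = ‖z‖ₑ := fun z => by
      rw [← ofReal_norm, ← ofReal_norm, RCLike.norm_conj]
    simp only [Φ, enorm_mul _ (conj _), h2]
    simp_rw [lintegral_const_mul _ hwm.enorm, lintegral_mul_const _ hwm.enorm]
    gcongr
  rw [weightedAutocorrelation_eq hC]
  -- By mass transport, `Φ` may be averaged over diagonal translates of a pair with first point in
  -- the cube. That average is the correlation of `h`, hence `𝓕 φ` at the difference of the points.
  have h1 : ∫ z, autocorrelationKernel w (𝓕 φ : 𝓢(Space d, ℂ)) z ∂secondMoment μ =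
      ∫ z, Φ z ∂secondMoment μ := by
    rw [integral_secondMoment_eq_cube hΦ hΦm]
    refine integral_congr_ae (ae_of_all _ fun z => ?_)
    have h2 : ∀ t, Φ (shift m t z.1, shift m t z.2) =
        (w z.1.2 : ℂ) * (w z.2.2 : ℂ) * (h (t + z.1.1) * conj (h (t + z.2.1))) := by
      intro t
      change ((w z.1.2 : ℂ) * h (t + z.1.1)) * conj ((w z.2.2 : ℂ) * h (t + z.2.1)) = _
      rw [map_mul, Complex.conj_ofReal]
      ring
    simp only [h2, integral_const_mul, integral_mul_conj_translate hφ, autocorrelationKernel]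
    ring
  rw [h1, integral_secondMoment hΦ, ← integral_complex_ofReal]
  refine integral_congr_ae (ae_of_all _ fun ν => ?_)
  simp only [Φ, integral_const_mul, integral_mul_const]
  rw [integral_conj, Complex.mul_conj, Complex.normSq_eq_norm_sq]
  rfl

end SecondMoment

end ColouredPointProcess

end

noncomputable section

namespace ColouredPointProcess

open scoped NNReal Topology ContDiff ComplexConjugate ComplexOrder
open Module ProbabilityTheory

/-! ### The diffraction measure and the isometric embedding -/

section Embedding

variable {d m : ℕ}

theorem exists_schwartz_normSq (ψ : 𝓢(Space d, ℂ)) :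
    ∃ φ : 𝓢(Space d, ℂ), ∀ x, φ x = ((‖ψ x‖ ^ 2 : ℝ) : ℂ) := by
  let ψ' : 𝓢(Space d, ℂ) := ψ.postcompCLM (𝕜 := ℝ) Complex.conjCLE.toContinuousLinearMap
  refine ⟨SchwartzMap.smulLeftCLM ℂ ψ' ψ, fun x => ?_⟩
  rw [SchwartzMap.smulLeftCLM_apply_apply ψ'.hasTemperateGrowth, SchwartzMap.postcompCLM_apply,
    smul_eq_mul, ← Complex.normSq_eq_norm_sq, ← Complex.mul_conj, mul_comm]
  rfl

theorem memLp_weightedCount {μ : Measure (PointMeasure d m)} [IsProbabilityMeasure μ] {C : ℝ≥0}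
    (hC : ∀ᵐ ν ∂μ, DecayBounded C ν) (w : Fin m → ℝ) (f : 𝓢(Space d, ℂ)) (p : ℝ≥0∞) :
    MemLp (weightedCount w f : PointMeasure d m → ℂ) p μ :=
  MemLp.of_bound (stronglyMeasurable_weightedCount w f.continuous.measurable).aestronglyMeasurable
    _ (hC.mono fun _ hν => norm_weightedCount_le w hν f)

/-- The weighted counting functions as a linear map into `L²`. -/
def weightedCountLp {μ : Measure (PointMeasure d m)} [IsProbabilityMeasure μ] {C : ℝ≥0}
    (hC : ∀ᵐ ν ∂μ, DecayBounded C ν) (w : Fin m → ℝ) : 𝓢(Space d, ℂ) →ₗ[ℂ] Lp ℂ 2 μ where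
  toFun f := (memLp_weightedCount hC w f 2).toLp
  map_add' f g := by
    rw [← MemLp.toLp_add]
    refine MemLp.toLp_congr _ _ (hC.mono fun ν hν => ?_)
    rw [Pi.add_apply]
    unfold weightedCount
    rw [← integral_add (integrable_weightedCount w hν f) (integrable_weightedCount w hν g)]
    refine integral_congr_ae (ae_of_all _ fun p => ?_)
    simp only [add_apply]
    ring
  map_smul' c f := by
    rw [RingHom.id_apply, ← MemLp.toLp_const_smul]
    refine MemLp.toLp_congr _ _ (ae_of_all _ fun ν => ?_)
    rw [Pi.smul_apply, smul_eq_mul]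
    unfold weightedCount
    rw [← integral_const_mul]
    refine integral_congr_ae (ae_of_all _ fun p => ?_)
    simp only [smul_apply, smul_eq_mul]
    ring

theorem weightedCountLp_ae_eq {μ : Measure (PointMeasure d m)} [IsProbabilityMeasure μ]
    {C : ℝ≥0} (hC : ∀ᵐ ν ∂μ, DecayBounded C ν) (w : Fin m → ℝ) (f : 𝓢(Space d, ℂ)) :
    weightedCountLp hC w f =ᵐ[μ] weightedCount w f :=
  (memLp_weightedCount hC w f 2).coeFn_toLp

theorem norm_weightedCountLp_sq {μ : Measure (PointMeasure d m)} [IsProbabilityMeasure μ]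
    {C : ℝ≥0} (hC : ∀ᵐ ν ∂μ, DecayBounded C ν) (w : Fin m → ℝ) (f : 𝓢(Space d, ℂ)) :
    ((‖weightedCountLp hC w f‖ ^ 2 : ℝ) : ℂ) = ((∫ ν, ‖weightedCount w f ν‖ ^ 2 ∂μ : ℝ) : ℂ) := by
  have h := inner_self_eq_norm_sq_to_K (𝕜 := ℂ) (weightedCountLp hC w f)
  rw [L2.inner_def] at h
  rw [← integral_complex_ofReal, Complex.ofReal_pow]
  refine h.symm.trans (integral_congr_ae ((weightedCountLp_ae_eq hC w f).mono fun ν hν => ?_))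
  simp only
  rw [hν, inner_self_eq_norm_sq_to_K]
  simp

theorem norm_toLp_sq {σ : Measure (Space d)} [σ.HasTemperateGrowth] {φ ψ : 𝓢(Space d, ℂ)}
    (hφ : ∀ x, φ x = ((‖ψ x‖ ^ 2 : ℝ) : ℂ)) :
    ((‖ψ.toLp 2 σ‖ ^ 2 : ℝ) : ℂ) = ∫ x, φ x ∂σ := by
  have h := (SchwartzMap.inner_toL2_toL2_eq ψ ψ σ).symm.trans
    (inner_self_eq_norm_sq_to_K (𝕜 := ℂ) (ψ.toLp 2 σ))
  rw [Complex.ofReal_pow]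
  refine h.symm.trans (integral_congr_ae (ae_of_all _ fun x => ?_))
  simp only
  rw [hφ, inner_self_eq_norm_sq_to_K]
  simp

theorem exists_diffraction {μ : Measure (PointMeasure d m)} [IsProbabilityMeasure μ]
    [VAddInvariantMeasure (Space d) (PointMeasure d m) μ]
    {C : ℝ≥0} (hC : ∀ᵐ ν ∂μ, DecayBounded C ν) (w : Fin m → ℝ) :
    ∃ (σ : Measure (Space d)) (_ : σ.HasTemperateGrowth), IsFiniteMeasureOnCompacts σ ∧
      IsDiffraction μ w σ := by
  let T : 𝓢(Space d, ℂ) →L[ℂ] ℂ :=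
    (autocorrelationCLM hC w).comp (FourierTransform.fourierCLM ℂ 𝓢(Space d, ℂ))
  have hTa : ∀ φ : 𝓢(Space d, ℂ), T φ = weightedAutocorrelation μ w (𝓕 φ : 𝓢(Space d, ℂ)) :=
    fun φ => autocorrelationCLM_apply hC w _
  have hTsq : ∀ φ ψ : 𝓢(Space d, ℂ), (∀ x, φ x = ((‖ψ x‖ ^ 2 : ℝ) : ℂ)) →
      T φ = ((∫ ν, ‖weightedCount w (𝓕⁻ ψ : 𝓢(Space d, ℂ)) ν‖ ^ 2 ∂μ : ℝ) : ℂ) := by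
    intro φ ψ h
    rw [hTa, integral_norm_weightedCount_sq hC w (φ := φ)]
    intro k
    rw [FourierTransform.fourier_fourierInv_eq, h]
  obtain ⟨σ, hσ, hfin, hint⟩ := exists_measure_of_nonneg_on_normSq (T := T)
    (fun φ ψ h => by
      rw [hTsq φ ψ h, Complex.zero_le_real]
      exact integral_nonneg fun _ => sq_nonneg _)
    (fun ψ => by
      refine ⟨(weightBound w * decayConst (𝓕⁻ ψ) * C) ^ 2, fun a φ h => ?_⟩
      rw [hTsq φ (SchwartzMap.compSubConstCLM ℂ a ψ) h, Complex.ofReal_re]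
      -- Translating `ψ` multiplies `𝓕⁻ ψ` by a phase, so the decay constant of the untranslated
      -- function serves for every `a`.
      have hnorm : ∀ x, ‖(𝓕⁻ (SchwartzMap.compSubConstCLM ℂ a ψ) : 𝓢(Space d, ℂ)) x‖ ≤
          decayConst (𝓕⁻ ψ) * decay (x - 0) := by
        intro x
        refine le_trans (le_of_eq ?_) (norm_schwartz_le (𝓕⁻ ψ) x)
        rw [SchwartzMap.fourierInv_apply_eq, SchwartzMap.fourierInv_apply_eq]
        change ‖𝓕 (SchwartzMap.compSubConstCLM ℂ a ψ) (-x)‖ = ‖𝓕 ψ (-x)‖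
        rw [fourier_compSubConst, Circle.smul_def, norm_smul, Circle.norm_coe, one_mul]
      calc ∫ ν, ‖weightedCount w (𝓕⁻ (SchwartzMap.compSubConstCLM ℂ a ψ) : 𝓢(Space d, ℂ)) ν‖ ^ 2 ∂μ
          ≤ ∫ _ν, (weightBound w * decayConst (𝓕⁻ ψ) * C) ^ 2 ∂μ := by
            refine integral_mono_ae ?_ (integrable_const _) (hC.mono fun ν hν => ?_)
            · exact (memLp_weightedCount hC w _ 2).integrable_norm_pow (by norm_num)
            · exact pow_le_pow_left₀ (norm_nonneg _) (norm_integral_weight_mul_le w hν 0 hnorm) 2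
        _ = _ := by simp)
  exact ⟨σ, hσ, hfin, fun φ => (hint φ).trans (hTa φ)⟩

/-- On Schwartz functions, both squared norms equal the autocorrelation at `𝓕 (|ψ|²)`; density in
`L²(σ)` extends the isometry. -/
theorem exists_diffractionEmbedding {μ : Measure (PointMeasure d m)} [IsProbabilityMeasure μ]
    [VAddInvariantMeasure (Space d) (PointMeasure d m) μ]
    {C : ℝ≥0} (hC : ∀ᵐ ν ∂μ, DecayBounded C ν) (w : Fin m → ℝ) (σ : Measure (Space d))
    [σ.HasTemperateGrowth] [IsFiniteMeasureOnCompacts σ] (hσ : IsDiffraction μ w σ) :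
    ∃ θ : Lp ℂ 2 σ →ₗᵢ[ℂ] Lp ℂ 2 μ, IsDiffractionEmbedding μ w σ θ := by
  let e : 𝓢(Space d, ℂ) →ₗ[ℂ] Lp ℂ 2 σ := (SchwartzMap.toLpCLM ℂ ℂ 2 σ).toLinearMap
  let F : 𝓢(Space d, ℂ) →ₗ[ℂ] Lp ℂ 2 μ := (weightedCountLp hC w).comp
    (FourierTransform.fourierInvCLM ℂ 𝓢(Space d, ℂ)).toLinearMap
  have he : DenseRange e :=
    SchwartzMap.denseRange_toLpCLM (F := ℂ) (p := 2) (μ := σ) (by norm_num)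
  have hnorm : ∀ ψ, ‖F ψ‖ = ‖e ψ‖ := by
    intro ψ
    obtain ⟨φ, hφ⟩ := exists_schwartz_normSq ψ
    have h1 : ((‖F ψ‖ ^ 2 : ℝ) : ℂ) = ((‖e ψ‖ ^ 2 : ℝ) : ℂ) := by
      refine (norm_weightedCountLp_sq hC w (𝓕⁻ ψ)).trans ?_
      refine Eq.trans ?_ (norm_toLp_sq (σ := σ) hφ).symm
      rw [hσ φ, integral_norm_weightedCount_sq hC w (φ := φ)]
      intro k
      rw [FourierTransform.fourier_fourierInv_eq, hφ]
    have h2 : ‖F ψ‖ ^ 2 = ‖e ψ‖ ^ 2 := by exact_mod_cast h1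
    exact (sq_eq_sq₀ (norm_nonneg _) (norm_nonneg _)).1 h2
  have hbd : ∃ c, ∀ ψ, ‖F ψ‖ ≤ c * ‖e ψ‖ := ⟨1, fun ψ => by rw [hnorm, one_mul]⟩
  let θ := F.extendOfNorm e
  have hθ : ∀ ψ, θ (e ψ) = F ψ := LinearMap.extendOfNorm_eq he hbd
  refine ⟨⟨θ.toLinearMap, fun x => ?_⟩, fun f => ?_⟩
  · refine he.induction_on (p := fun x => ‖θ x‖ = ‖x‖) x
      (isClosed_eq (by fun_prop) (by fun_prop)) fun ψ => ?_
    rw [hθ, hnorm]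
  · have h1 : θ (e (𝓕 f)) = weightedCountLp hC w f := by
      rw [hθ]
      change weightedCountLp hC w (𝓕⁻ (𝓕 f)) = _
      rw [FourierTransform.fourierInv_fourier_eq]
    change θ (e (𝓕 f)) =ᵐ[μ] _
    rw [h1]
    exact weightedCountLp_ae_eq hC w f

end Embedding

end ColouredPointProcess

end

noncomputable section

namespace ColouredPointProcess

open scoped NNReal Topology

/-! ### Density in `L²` of algebras of bounded functions -/

section BoundedAlgebra

variable {Ω : Type*} [mΩ : MeasurableSpace Ω]

/-- A bounded function that is approximated in `L²(μ)` by the elements of the algebra `A`. -/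
structure BoundedApprox (μ : Measure Ω) (A : Subalgebra ℂ (Ω → ℂ)) (G : Ω → ℂ) : Prop where
  aestronglyMeasurable : AEStronglyMeasurable G μ
  bounded : ∃ c : ℝ, 0 ≤ c ∧ ∀ᵐ x ∂μ, ‖G x‖ ≤ c
  approx : ∀ ε : ℝ≥0∞, ε ≠ 0 → ∃ F ∈ A, eLpNorm (G - F) 2 μ ≤ ε

variable {μ : Measure Ω} {A : Subalgebra ℂ (Ω → ℂ)}

/-- An algebra of essentially bounded functions. -/
def IsBoundedAlgebra (μ : Measure Ω) (A : Subalgebra ℂ (Ω → ℂ)) : Prop :=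
  ∀ F ∈ A, AEStronglyMeasurable F μ ∧ ∃ c : ℝ, 0 ≤ c ∧ ∀ᵐ x ∂μ, ‖F x‖ ≤ c

theorem IsBoundedAlgebra.boundedApprox (hA : IsBoundedAlgebra μ A) {F : Ω → ℂ} (hF : F ∈ A) :
    BoundedApprox μ A F :=
  ⟨(hA F hF).1, (hA F hF).2, fun ε _ => ⟨F, hF, by simp⟩⟩

theorem BoundedApprox.congr_ae {G H : Ω → ℂ} (hG : BoundedApprox μ A G) (h : G =ᵐ[μ] H) :
    BoundedApprox μ A H := by
  obtain ⟨c, hc0, hc⟩ := hG.bounded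
  refine ⟨hG.1.congr h, ⟨c, hc0, ?_⟩, fun ε hε => ?_⟩
  · filter_upwards [hc, h] with x h1 h2
    rwa [← h2]
  · obtain ⟨F, hF, hFε⟩ := hG.approx ε hε
    refine ⟨F, hF, (eLpNorm_congr_ae ?_).trans_le hFε⟩
    exact h.symm.sub (EventuallyEq.refl _ _)

theorem BoundedApprox.sub (hA : IsBoundedAlgebra μ A) {G H : Ω → ℂ} (hG : BoundedApprox μ A G)
    (hH : BoundedApprox μ A H) : BoundedApprox μ A (G - H) := by
  obtain ⟨c, hc0, hc⟩ := hG.bounded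
  obtain ⟨c', hc0', hc'⟩ := hH.bounded
  refine ⟨hG.1.sub hH.1, ⟨c + c', by positivity, ?_⟩, fun ε hε => ?_⟩
  · filter_upwards [hc, hc'] with x h1 h2
    exact (norm_sub_le _ _).trans (add_le_add h1 h2)
  · obtain ⟨F, hF, hFε⟩ := hG.approx (ε / 2) (by simpa using hε)
    obtain ⟨F', hF', hFε'⟩ := hH.approx (ε / 2) (by simpa using hε)
    refine ⟨F - F', sub_mem hF hF', ?_⟩
    have : G - H - (F - F') = (G - F) - (H - F') := by abel
    rw [this]
    refine (eLpNorm_sub_le (hG.1.sub (hA F hF).1) (hH.1.sub (hA F' hF').1) (by norm_num)).trans ?_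
    exact (add_le_add hFε hFε').trans_eq (ENNReal.add_halves ε)

theorem BoundedApprox.mul (hA : IsBoundedAlgebra μ A) {G H : Ω → ℂ} (hG : BoundedApprox μ A G)
    (hH : BoundedApprox μ A H) : BoundedApprox μ A (G * H) := by
  obtain ⟨c, hc0, hc⟩ := hG.bounded
  obtain ⟨c', hc0', hc'⟩ := hH.bounded
  refine ⟨hG.1.mul hH.1, ⟨c * c', by positivity, ?_⟩, fun ε hε => ?_⟩
  · filter_upwards [hc, hc'] with x h1 h2
    rw [Pi.mul_apply, norm_mul]
    exact mul_le_mul h1 h2 (norm_nonneg _) hc0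
  have hε2 : ε / 2 ≠ 0 := by simpa using hε
  have key : ∀ (a : ℝ) (δ : ℝ≥0∞), δ ≤ ε / 2 / ENNReal.ofReal (a + 1) →
      ENNReal.ofReal a * δ ≤ ε / 2 := by
    intro a δ h
    calc ENNReal.ofReal a * δ ≤ ENNReal.ofReal (a + 1) * (ε / 2 / ENNReal.ofReal (a + 1)) := by
          gcongr; linarith
      _ ≤ ε / 2 := ENNReal.mul_div_le
  -- `F'` is chosen before `F`: in `G H - F F' = G (H - F') + F' (G - F)` the bound `b` of `F'`
  -- decides how close `F` must be to `G`. The `+ 1` in the denominators excludes division by zero.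
  obtain ⟨F', hF', hFε'⟩ := hH.approx (ε / 2 / ENNReal.ofReal (c + 1))
    (ENNReal.div_ne_zero.2 ⟨hε2, ENNReal.ofReal_ne_top⟩)
  obtain ⟨b, hb0, hb⟩ := (hA F' hF').2
  obtain ⟨F, hF, hFε⟩ := hG.approx (ε / 2 / ENNReal.ofReal (b + 1))
    (ENNReal.div_ne_zero.2 ⟨hε2, ENNReal.ofReal_ne_top⟩)
  refine ⟨F * F', mul_mem hF hF', ?_⟩
  have h1 : G * H - F * F' = G * (H - F') + F' * (G - F) := by ring
  rw [h1]
  refine (eLpNorm_add_le (hG.1.mul (hH.1.sub (hA F' hF').1))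
    ((hA F' hF').1.mul (hG.1.sub (hA F hF).1)) (by norm_num)).trans ?_
  refine (add_le_add ?_ ?_).trans_eq (ENNReal.add_halves ε)
  · refine (eLpNorm_le_mul_eLpNorm_of_ae_le_mul (c := c) (g := H - F') ?_ 2).trans (key c _ hFε')
    filter_upwards [hc] with x hx
    rw [Pi.mul_apply, norm_mul]
    gcongr
  · refine (eLpNorm_le_mul_eLpNorm_of_ae_le_mul (c := b) (g := G - F) ?_ 2).trans (key b _ hFε)
    filter_upwards [hb] with x hx
    rw [Pi.mul_apply, norm_mul]
    gcongr

/-- The common bound `c` makes the sequence uniformly integrable in `L²`, so Vitali's theorem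
upgrades almost everywhere convergence to `L²` convergence. -/
theorem BoundedApprox.of_tendsto [IsFiniteMeasure μ] (hA : IsBoundedAlgebra μ A)
    {G : ℕ → Ω → ℂ} {H : Ω → ℂ} (hG : ∀ n, BoundedApprox μ A (G n)) {c : ℝ} (hc0 : 0 ≤ c)
    (hc : ∀ n, ∀ᵐ x ∂μ, ‖G n x‖ ≤ c)
    (hlim : ∀ᵐ x ∂μ, Tendsto (fun n => G n x) atTop (𝓝 (H x))) : BoundedApprox μ A H := by
  have hHm : AEStronglyMeasurable H μ := aestronglyMeasurable_of_tendsto_ae atTop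
    (fun n => (hG n).1) hlim
  have hHc : ∀ᵐ x ∂μ, ‖H x‖ ≤ c := by
    filter_upwards [hlim, ae_all_iff.2 hc] with x h1 h2
    exact le_of_tendsto h1.norm (Eventually.of_forall h2)
  have hunif : UnifIntegrable G 2 μ := by
    refine unifIntegrable_of (by norm_num) (by norm_num) (fun n => (hG n).1) fun ε hε => ?_
    refine ⟨(c + 1).toNNReal, fun n => ?_⟩
    have : Set.indicator {x | (c + 1).toNNReal ≤ ‖G n x‖₊} (G n) =ᵐ[μ] 0 := by
      filter_upwards [hc n] with x hx
      refine Set.indicator_of_notMem (fun h => ?_) _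
      have h' : ((c + 1).toNNReal : ℝ) ≤ ‖G n x‖ := h
      rw [Real.coe_toNNReal _ (by positivity)] at h'
      linarith
    rw [eLpNorm_congr_ae this, eLpNorm_zero]
    exact zero_le
  have hconv := tendsto_Lp_finite_of_tendsto_ae (p := 2) (by norm_num) (by norm_num)
    (fun n => (hG n).1) (MemLp.of_bound hHm c hHc) hunif hlim
  refine ⟨hHm, ⟨c, hc0, hHc⟩, fun ε hε => ?_⟩
  have hε2 : ε / 2 ≠ 0 := by simpa using hε
  obtain ⟨n, hn⟩ := (hconv.eventually (gt_mem_nhds (pos_iff_ne_zero.2 hε2))).exists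
  obtain ⟨F, hF, hFε⟩ := (hG n).approx (ε / 2) hε2
  refine ⟨F, hF, ?_⟩
  have : H - F = (G n - F) - (G n - H) := by abel
  rw [this]
  refine (eLpNorm_sub_le ((hG n).1.sub (hA F hF).1) ((hG n).1.sub hHm) (by norm_num)).trans ?_
  exact (add_le_add hFε hn.le).trans_eq (ENNReal.add_halves ε)

/-- Polynomials in `f` stay in the algebra. As `f` is essentially bounded, Weierstrass approximation
on a compact interval reaches every continuous `g`. -/
theorem BoundedApprox.comp_continuous [IsFiniteMeasure μ] (hA : IsBoundedAlgebra μ A)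
    {f : Ω → ℝ} (hfm : Measurable f) (hf : (fun x => (f x : ℂ)) ∈ A) {g : ℝ → ℝ}
    (hg : Continuous g) : BoundedApprox μ A fun x => (g (f x) : ℂ) := by
  obtain ⟨c, hc0, hc⟩ := (hA _ hf).2
  have hc' : ∀ᵐ x ∂μ, f x ∈ Set.Icc (-c) c := by
    filter_upwards [hc] with x hx
    rw [Complex.norm_real] at hx
    exact abs_le.1 hx
  have hpoly : ∀ p : Polynomial ℝ, (fun x => ((p.eval (f x) : ℝ) : ℂ)) ∈ A := by
    intro p
    have h2 := (Polynomial.aeval (⟨_, hf⟩ : A) (p.map (algebraMap ℝ ℂ))).2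
    convert h2 using 1
    rw [Polynomial.aeval_subalgebra_coe]
    funext x
    rw [Polynomial.aeval_fn_apply, Polynomial.aeval_map_algebraMap]
    have := Polynomial.aeval_algebraMap_apply ℂ (f x) p
    rw [Polynomial.coe_aeval_eq_eval] at this
    exact this.symm
  obtain ⟨b, hb⟩ := isCompact_Icc.exists_bound_of_continuousOn (s := Set.Icc (-c) c) hg.continuousOn
  refine ⟨(Complex.measurable_ofReal.comp (hg.measurable.comp hfm)).aestronglyMeasurable,
    ⟨max b 0, le_max_right _ _, ?_⟩, fun ε hε => ?_⟩
  · filter_upwards [hc'] with x hx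
    rw [Complex.norm_real]
    exact (hb _ hx).trans (le_max_left _ _)
  obtain ⟨δ, hδ, hδε⟩ : ∃ δ : ℝ, 0 < δ ∧
      μ Set.univ ^ (2 : ℝ≥0∞).toReal⁻¹ * ENNReal.ofReal δ ≤ ε := by
    have ht : Tendsto (fun δ : ℝ => μ Set.univ ^ (2 : ℝ≥0∞).toReal⁻¹ * ENNReal.ofReal δ) (𝓝[>] 0)
        (𝓝 (μ Set.univ ^ (2 : ℝ≥0∞).toReal⁻¹ * ENNReal.ofReal 0)) := by
      refine ENNReal.Tendsto.const_mul ?_ (Or.inr ?_)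
      · exact (ENNReal.continuous_ofReal.tendsto 0).mono_left nhdsWithin_le_nhds
      · exact ENNReal.rpow_ne_top_of_nonneg (by positivity) (measure_ne_top _ _)
    rw [ENNReal.ofReal_zero, mul_zero] at ht
    obtain ⟨δ, h1, h2⟩ := ((ht.eventually (gt_mem_nhds (pos_iff_ne_zero.2 hε))).and
      self_mem_nhdsWithin).exists
    exact ⟨δ, h2, h1.le⟩
  obtain ⟨p, hp⟩ := exists_polynomial_near_of_continuousOn (-c) c g hg.continuousOn δ hδ
  refine ⟨_, hpoly p, (eLpNorm_le_of_ae_bound (C := δ) ?_).trans hδε⟩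
  filter_upwards [hc'] with x hx
  rw [Pi.sub_apply, ← Complex.ofReal_sub, Complex.norm_real, norm_sub_rev]
  exact (hp _ hx).le

/-- The sets whose indicator functions are approximated by the algebra `A` form a `σ`-algebra. -/
abbrev approxMeasurableSpace [IsFiniteMeasure μ] (hA : IsBoundedAlgebra μ A) : MeasurableSpace Ω where
  MeasurableSet' B := MeasurableSet B ∧ BoundedApprox μ A (B.indicator 1)
  measurableSet_empty := ⟨MeasurableSet.empty, by
    rw [Set.indicator_empty]
    exact hA.boundedApprox A.zero_mem⟩
  measurableSet_compl B hB := ⟨hB.1.compl, by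
    rw [Set.indicator_compl]
    exact (hA.boundedApprox A.one_mem).sub hA hB.2⟩
  measurableSet_iUnion B hB := by
    refine ⟨MeasurableSet.iUnion fun n => (hB n).1, ?_⟩
    -- Complements turn finite unions into intersections, whose indicators are products.
    have hfin : ∀ n, BoundedApprox μ A ((Set.accumulate B n)ᶜ.indicator 1) := by
      intro n
      induction n with
      | zero =>
        rw [Set.accumulate_zero_nat, Set.indicator_compl]
        exact (hA.boundedApprox A.one_mem).sub hA (hB 0).2
      | succ n ih =>
        rw [Set.accumulate_succ, Set.compl_union, Set.inter_indicator_one]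
        refine ih.mul hA ?_
        rw [Set.indicator_compl]
        exact (hA.boundedApprox A.one_mem).sub hA (hB _).2
    have hfin' : ∀ n, BoundedApprox μ A ((Set.accumulate B n).indicator 1) := by
      intro n
      have := (hA.boundedApprox A.one_mem).sub hA (hfin n)
      rwa [← Set.indicator_compl, compl_compl] at this
    refine BoundedApprox.of_tendsto hA hfin' zero_le_one (fun n => ae_of_all _ fun x => ?_)
      (ae_of_all _ fun x => ?_)
    · refine (norm_indicator_le_norm_self _ _).trans ?_
      simp
    · have := (Set.monotone_accumulate (s := B)).tendsto_indicator _ (1 : Ω → ℂ) x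
      rw [Set.iUnion_accumulate] at this
      exact this.mono_right (pure_le_nhds _)

theorem measurable_approxMeasurableSpace [IsFiniteMeasure μ] (hA : IsBoundedAlgebra μ A)
    {f : Ω → ℝ} (hfm : Measurable f) (hf : (fun x => (f x : ℂ)) ∈ A) :
    Measurable[approxMeasurableSpace hA] f := by
  refine measurable_of_Ioi (mδ := approxMeasurableSpace hA) fun a => ?_
  refine ⟨hfm measurableSet_Ioi, ?_⟩
  -- Continuous functions with values in `[0, 1]` that converge pointwise to the indicator of `(a,
  -- ∞)`.
  let g : ℕ → ℝ → ℝ := fun n x => min 1 (n * max 0 (x - a))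
  have hg : ∀ n, Continuous (g n) := fun n => by fun_prop
  refine BoundedApprox.of_tendsto hA (fun n => BoundedApprox.comp_continuous hA hfm hf (hg n))
    zero_le_one (fun n => ae_of_all _ fun x => ?_) (ae_of_all _ fun x => ?_)
  · rw [Complex.norm_real, Real.norm_of_nonneg (le_min zero_le_one (by positivity))]
    exact min_le_left _ _
  · by_cases hx : a < f x
    · rw [Set.indicator_of_mem (show x ∈ f ⁻¹' Set.Ioi a from hx), Pi.one_apply]
      refine tendsto_const_nhds.congr' ?_
      obtain ⟨N, hN⟩ := exists_nat_ge (f x - a)⁻¹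
      filter_upwards [eventually_ge_atTop N] with n hn
      have h1 : 0 < f x - a := sub_pos.2 hx
      have h2 : 1 ≤ (n : ℝ) * (f x - a) := by
        rw [← div_le_iff₀ h1, one_div]
        exact hN.trans (by exact_mod_cast hn)
      simp only [g]
      rw [max_eq_right h1.le, min_eq_left h2, Complex.ofReal_one]
    · rw [Set.indicator_of_notMem (show x ∉ f ⁻¹' Set.Ioi a from hx)]
      refine tendsto_const_nhds.congr fun n => ?_
      simp only [g]
      rw [max_eq_left (by linarith [not_lt.1 hx]), mul_zero, min_eq_right zero_le_one,
        Complex.ofReal_zero]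

/-- **Density of bounded algebras**: an algebra of bounded functions is dense in `L²(μ)` if its
real elements and the null sets generate the `σ`-algebra. -/
theorem exists_mem_eLpNorm_sub_le [IsFiniteMeasure μ] (hA : IsBoundedAlgebra μ A)
    (hgen : ∀ 𝒢 : MeasurableSpace Ω, (∀ B, MeasurableSet[mΩ] B → μ B = 0 → MeasurableSet[𝒢] B) →
      (∀ f : Ω → ℝ, Measurable[mΩ] f → (fun x => (f x : ℂ)) ∈ A → Measurable[𝒢] f) → mΩ ≤ 𝒢)
    {G : Ω → ℂ} (hG : MemLp G 2 μ) {ε : ℝ≥0∞} (hε : ε ≠ 0) :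
    ∃ F, eLpNorm (G - F) 2 μ ≤ ε ∧ F ∈ A := by
  have hall := hgen (approxMeasurableSpace hA)
    (fun B hB h0 => ⟨hB, (hA.boundedApprox A.zero_mem).congr_ae
      (indicator_meas_zero h0).symm⟩)
    (fun f hfm hf => measurable_approxMeasurableSpace hA hfm hf)
  refine MemLp.induction_dense (by norm_num) (· ∈ A) (fun c s hs _ ε hε => ?_)
    (fun f g hf hg => add_mem hf hg) (fun f hf => (hA f hf).1) hG hε
  have h1 := ((hA.boundedApprox (A.smul_mem A.one_mem c)).mul hA (hall s hs).2).approx ε hε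
  obtain ⟨F, hF, hFε⟩ := h1
  refine ⟨F, ?_, hF⟩
  rw [eLpNorm_sub_comm]
  convert hFε using 3
  funext x
  by_cases hx : x ∈ s <;> simp [hx]

end BoundedAlgebra

end ColouredPointProcess

end

noncomputable section

namespace ColouredPointProcess

open scoped NNReal Topology ContDiff

/-! ### Recovering the configuration from its weighted counts -/

section Recovery

variable {d m : ℕ}

theorem isBounded_cube (a : Space d) (r : ℝ) : Bornology.IsBounded (cube a r) := by
  -- The radius uses `s ≤ s² + 1`, which avoids a square root.
  refine (Metric.isBounded_closedBall (x := a) (r := d * (r / 2) ^ 2 + 1)).subset fun x hx => ?_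
  rw [mem_closedBall_iff_norm]
  have h1 : ‖x - a‖ ^ 2 ≤ d * (r / 2) ^ 2 := by
    rw [EuclideanSpace.norm_sq_eq]
    calc ∑ i, ‖(x - a) i‖ ^ 2 ≤ ∑ _i : Fin d, (r / 2) ^ 2 := by
          refine Finset.sum_le_sum fun i _ => ?_
          rw [PiLp.sub_apply, Real.norm_eq_abs]
          exact pow_le_pow_left₀ (abs_nonneg _) (hx i).le 2
      _ = _ := by simp
  nlinarith [norm_nonneg (x - a)]

/-- The coloured points over the cube of edge length `r` about `a`. -/
def colouredCube (m : ℕ) (a : Space d) (r : ℝ) : Set (Space d × Fin m) := cube a r ×ˢ Set.univ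

theorem measurableSet_colouredCube (a : Space d) (r : ℝ) :
    MeasurableSet (colouredCube m a r) :=
  (isOpen_cube a r).measurableSet.prod MeasurableSet.univ

theorem isCompact_closure_of_subset_colouredCube {a : Space d} {r : ℝ}
    {T : Set (Space d × Fin m)} (hT : T ⊆ colouredCube m a r) : IsCompact (closure T) := by
  have h : IsCompact (closure (cube a r) ×ˢ (Set.univ : Set (Fin m))) :=
    (isBounded_cube a r).isCompact_closure.prod isCompact_univ
  refine h.of_isClosed_subset isClosed_closure (closure_minimal (hT.trans ?_) h.isClosed)
  exact Set.prod_mono subset_closure subset_rfl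

/-- A point measure with at most one point in a cube is zero or a Dirac mass there. -/
theorem restrict_colouredCube_eq {ν : PointMeasure d m} {a : Space d} {r : ℝ}
    (hν : ν.1 (colouredCube m a r) ≤ 1) :
    ν.1.restrict (colouredCube m a r) = 0 ∨
      ∃ p, ν.1.restrict (colouredCube m a r) = Measure.dirac p := by
  set Q := colouredCube m a r with hQdef
  have hQ : MeasurableSet Q := measurableSet_colouredCube a r
  have h01 : ∀ T, MeasurableSet T → ν.1.restrict Q T = 0 ∨ ν.1.restrict Q T = 1 := by
    intro T hT
    rw [Measure.restrict_apply hT]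
    obtain ⟨n, hn⟩ := ν.2 (T ∩ Q) (hT.inter hQ)
      (isCompact_closure_of_subset_colouredCube Set.inter_subset_right)
    have h1 : (n : ℝ≥0∞) ≤ 1 := hn ▸ (measure_mono Set.inter_subset_right).trans hν
    have h2 : n ≤ 1 := by exact_mod_cast h1
    rw [hn]
    interval_cases n <;> simp
  rcases h01 Set.univ MeasurableSet.univ with h | h
  · exact Or.inl (Measure.measure_univ_eq_zero.1 h)
  right
  have hprob : IsProbabilityMeasure (ν.1.restrict Q) := ⟨h⟩
  have hne : Nonempty (Space d × Fin m) :=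
    (ν.1.restrict Q).nonempty_of_neZero
  have hmem : ∀ T, MeasurableSet T → T ∈ ae (ν.1.restrict Q) ∨ Tᶜ ∈ ae (ν.1.restrict Q) := by
    intro T hT
    rcases h01 T hT with h0 | h1
    · right
      rwa [mem_ae_iff, compl_compl]
    · left
      rwa [mem_ae_iff, prob_compl_eq_zero_iff hT]
  -- A probability measure with values in `{0, 1}` decides every measurable set. Countably many of
  -- these separate points, so all the mass sits at one point.
  obtain ⟨p, hp⟩ := Filter.exists_singleton_mem_of_forall_separating MeasurableSet hmem
  refine ⟨p, Measure.ext fun T hT => ?_⟩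
  rw [Measure.dirac_apply' _ hT]
  by_cases hpT : p ∈ T
  · rw [Set.indicator_of_mem hpT, Pi.one_apply, ← prob_compl_eq_zero_iff hT, ← mem_ae_iff]
    exact mem_of_superset hp (Set.singleton_subset_iff.2 hpT)
  · rw [Set.indicator_of_notMem hpT]
    refine measure_mono_null (fun x hx => ?_) (mem_ae_iff.1 hp)
    rintro rfl
    exact hpT hx

/-- The real weighted count. -/
def realCount (w : Fin m → ℝ) (f : Space d → ℝ) (ν : PointMeasure d m) : ℝ :=
  ∫ p, w p.2 * f p.1 ∂ν.1

theorem weightedCount_ofReal (w : Fin m → ℝ) (f : Space d → ℝ) (ν : PointMeasure d m) :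
    weightedCount w (fun x => (f x : ℂ)) ν = realCount w f ν := by
  unfold weightedCount realCount
  rw [← integral_complex_ofReal]
  simp only [Complex.ofReal_mul]

theorem realCount_eq_of_support_subset (w : Fin m → ℝ) {f : Space d → ℝ} {a : Space d} {r : ℝ}
    (hf : Function.support f ⊆ cube a r) (ν : PointMeasure d m) :
    realCount w f ν = ∫ p, w p.2 * f p.1 ∂ν.1.restrict (colouredCube m a r) := by
  unfold realCount
  rw [setIntegral_eq_integral_of_forall_compl_eq_zero]
  intro p hp
  have : f p.1 = 0 := by
    by_contra h
    exact hp ⟨hf h, Set.mem_univ _⟩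
  rw [this, mul_zero]

/-- If a cube contains at most one point, the colour of the point is determined by the weighted
counts, since the weights are distinct and nonzero. -/
theorem measure_prod_singleton_eq {w : Fin m → ℝ} (hinj : Function.Injective w)
    (hne : ∀ i, w i ≠ 0) {ν : PointMeasure d m} {a : Space d} {r : ℝ}
    (hν : ν.1 (colouredCube m a r) ≤ 1) {f : Space d → ℝ} (hf : Function.support f ⊆ cube a r)
    (hU : MeasurableSet (Function.support f)) (i : Fin m) :
    ν.1 (Function.support f ×ˢ {i}) =
      Set.indicator {w i} (fun _ => 1)
        (realCount w f ν ^ 2 / realCount w (fun x => f x ^ 2) ν) := by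
  have hf2 : Function.support (fun x => f x ^ 2) ⊆ cube a r := by
    intro x hx
    refine hf fun h => hx ?_
    simp only
    rw [h]; simp
  have hsub : Function.support f ×ˢ {i} ⊆ colouredCube m a r := fun p hp => ⟨hf hp.1, Set.mem_univ _⟩
  have hS : MeasurableSet (Function.support f ×ˢ ({i} : Set (Fin m))) :=
    hU.prod (MeasurableSet.singleton i)
  rw [← Measure.restrict_eq_self _ hsub, realCount_eq_of_support_subset w hf,
    realCount_eq_of_support_subset w hf2]
  rcases restrict_colouredCube_eq hν with h | ⟨p, h⟩
  · rw [h]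
    simp only [integral_zero_measure, Measure.coe_zero, Pi.zero_apply]
    rw [Set.indicator_of_notMem]
    -- With no point in the cube the quotient is `0 / 0 = 0`, which differs from the nonzero weight
    -- `w i`.
    simpa using (hne i).symm
  · rw [h, integral_dirac, integral_dirac, Measure.dirac_apply' _ hS]
    by_cases hp : f p.1 = 0
    · rw [Set.indicator_of_notMem (fun h => h.1 hp), hp, Set.indicator_of_notMem]
      simpa using (hne i).symm
    · have h1 : (w p.2 * f p.1) ^ 2 / (w p.2 * f p.1 ^ 2) = w p.2 := by
        have := hne p.2
        field_simp
      rw [h1]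
      by_cases hi : p.2 = i
      · rw [Set.indicator_of_mem (show p ∈ _ ×ˢ _ from ⟨hp, hi⟩),
          Set.indicator_of_mem (show w p.2 ∈ ({w i} : Set ℝ) by rw [hi]; rfl), Pi.one_apply]
      · rw [Set.indicator_of_notMem (fun h => hi h.2),
          Set.indicator_of_notMem (show w p.2 ∉ ({w i} : Set ℝ) from fun h => hi (hinj h))]

/-- The exceptional set is enlarged to a measurable one, so that it belongs to any `σ`-algebra
containing the measurable null sets. -/
theorem IsUniformlyDiscrete.exists_null_set {μ : Measure (PointMeasure d m)}
    (hμ : IsUniformlyDiscrete μ) :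
    ∃ r : ℝ, 0 < r ∧ ∃ N : Set (PointMeasure d m), MeasurableSet N ∧ μ N = 0 ∧
      ∀ ν ∉ N, ∀ a, ν.1 (colouredCube m a r) ≤ 1 := by
  obtain ⟨r, hr, hν⟩ := hμ
  obtain ⟨N, hN, hNm, hN0⟩ := exists_measurable_superset_of_null (ae_iff.1 hν)
  refine ⟨r, hr, N, hNm, hN0, fun ν h a => ?_⟩
  by_contra h'
  exact h (hN fun h'' => h' (h'' a))

/-- The weighted counts determine a uniformly discrete coloured point process: a `σ`-algebra
containing the null sets for which all weighted counts are measurable is the full one. -/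
theorem measurableSpace_le_of_measurable_realCount {μ : Measure (PointMeasure d m)}
    (hμ : IsUniformlyDiscrete μ) {w : Fin m → ℝ} (hinj : Function.Injective w)
    (hne : ∀ i, w i ≠ 0) (𝒢 : MeasurableSpace (PointMeasure d m))
    (hnull : ∀ B, MeasurableSet[instMeasurableSpacePointMeasure d m] B → μ B = 0 →
      MeasurableSet[𝒢] B)
    (hcount : ∀ f : Space d → ℝ, HasCompactSupport f → ContDiff ℝ ∞ f →
      Measurable[𝒢] (realCount w f : PointMeasure d m → ℝ)) :
    instMeasurableSpacePointMeasure d m ≤ 𝒢 := by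
  obtain ⟨r, hr, N, hNm, hN0, hgood⟩ := hμ.exists_null_set
  have hN𝒢 : MeasurableSet[𝒢] N := hnull N hNm hN0
  classical
  -- the restriction of the process to a small cube
  let κ : Space d → PointMeasure d m → Measure (Space d × Fin m) := fun a ν =>
    if ν ∈ N then 0 else ν.1.restrict (colouredCube m a r)
  have hκfin : ∀ a ν, IsFiniteMeasure (κ a ν) := by
    intro a ν
    simp only [κ]
    split_ifs with h
    · infer_instance
    · exact ⟨by
        rw [Measure.restrict_apply_univ]
        exact (hgood ν h a).trans_lt ENNReal.one_lt_top⟩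
  have hbasic : ∀ a, ∀ s ∈ Set.image2 (fun (U : Set (Space d)) (t : Set (Fin m)) => U ×ˢ t)
      {U | IsOpen U} {t | MeasurableSet t}, Measurable[𝒢] fun ν => κ a ν s := by
    rintro a _ ⟨U, hU, t, -, rfl⟩
    have hU' : IsOpen (U ∩ cube a r) := IsOpen.inter hU (isOpen_cube a r)
    -- Every open set is exactly the support of a smooth function, so the counts of all open subsets
    -- of the cube, colour by colour, are within reach.
    obtain ⟨f, hsupp, hs, -⟩ := hU'.exists_contDiff_support_eq (n := ⊤)
    have hfa : Function.support f ⊆ cube a r := hsupp ▸ Set.inter_subset_right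
    have hfm : MeasurableSet (Function.support f) := hsupp ▸ hU'.measurableSet
    have hc : HasCompactSupport f := ((isBounded_cube a r).subset hfa).isCompact_closure
    have hc2 : HasCompactSupport fun x => f x ^ 2 :=
      hc.comp_left (g := fun t => t ^ 2) (by simp)
    have hmeas : ∀ i : Fin m, Measurable[𝒢] fun ν => Set.indicator {w i} (fun _ => (1 : ℝ≥0∞))
        (realCount w f ν ^ 2 / realCount w (fun x => f x ^ 2) ν) := by
      intro i
      refine (measurable_const.indicator (measurableSet_singleton _)).comp ?_
      exact ((hcount f hc hs).pow_const 2).div (hcount _ hc2 (hs.pow 2))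
    have heq : (fun ν => κ a ν (U ×ˢ t)) = fun ν => if ν ∈ N then 0 else
        ∑ i ∈ t.toFinset, Set.indicator {w i} (fun _ => (1 : ℝ≥0∞))
          (realCount w f ν ^ 2 / realCount w (fun x => f x ^ 2) ν) := by
      funext ν
      simp only [κ]
      split_ifs with h
      · rfl
      · have h1 : (U ×ˢ t) ∩ colouredCube m a r = ⋃ i ∈ t.toFinset, Function.support f ×ˢ {i} := by
          rw [hsupp]
          ext ⟨x, j⟩
          simp [colouredCube, and_assoc, and_comm, and_left_comm]
        rw [Measure.restrict_apply' (measurableSet_colouredCube a r), h1,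
          measure_biUnion_finset (fun i _ j _ hij => ?_)
            (fun i _ => hfm.prod (MeasurableSet.singleton i))]
        · exact Finset.sum_congr rfl fun i _ =>
            measure_prod_singleton_eq hinj hne (hgood ν h a) hfa hfm i
        · exact Set.disjoint_left.2 fun p hp hq => hij (hp.2.symm.trans hq.2)
    rw [heq]
    exact Measurable.ite hN𝒢 measurable_const (Finset.measurable_sum _ fun i _ => hmeas i)
  have hκ : ∀ a, Measurable[𝒢] (κ a) := by
    intro a
    have hspan : IsCountablySpanning {U : Set (Space d) | IsOpen U} :=
      ⟨fun _ => Set.univ, fun _ => isOpen_univ (X := Space d), Set.iUnion_const _⟩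
    refine Measurable.measure_of_isPiSystem (mα := 𝒢) ?_
      (isPiSystem_isOpen.prod MeasurableSpace.isPiSystem_measurableSet) (hbasic a) ?_
    · rw [← generateFrom_prod_eq hspan isCountablySpanning_measurableSet,
        MeasurableSpace.generateFrom_measurableSet]
      congr 1
      exact BorelSpace.measurable_eq
    · rw [← Set.univ_prod_univ]
      exact hbasic a _ ⟨_, isOpen_univ (X := Space d), _, MeasurableSet.univ (α := Fin m), rfl⟩
  -- gluing the restrictions
  let κ' : PointMeasure d m → Measure (Space d × Fin m) := fun ν => if ν ∈ N then 0 else ν.1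
  let B : ℕ → Set (Space d × Fin m) := fun n =>
    colouredCube m (TopologicalSpace.denseSeq (Space d) n) r
  have hBm : ∀ n, MeasurableSet (disjointed B n) := fun n =>
    MeasurableSet.disjointed (fun k => measurableSet_colouredCube _ r) n
  have hBU : ⋃ n, disjointed B n = Set.univ := by
    rw [iUnion_disjointed, Set.eq_univ_iff_forall]
    intro p
    obtain ⟨n, hn⟩ := (TopologicalSpace.denseRange_denseSeq (Space d)).exists_dist_lt p.1
      (half_pos hr)
    exact Set.mem_iUnion.2 ⟨n, ball_subset_cube _ r hn, Set.mem_univ _⟩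
  have hκ' : Measurable[𝒢] κ' := by
    refine @Measure.measurable_of_measurable_coe _ _ _ 𝒢 _ fun T hT => ?_
    have heq : (fun ν => κ' ν T) = fun ν => ∑' n,
        κ (TopologicalSpace.denseSeq (Space d) n) ν (T ∩ disjointed B n) := by
      funext ν
      simp only [κ', κ]
      split_ifs with h
      · simp
      · conv_lhs => rw [← Set.inter_univ T, ← hBU, Set.inter_iUnion]
        rw [measure_iUnion]
        · refine tsum_congr fun n => (Measure.restrict_eq_self _ ?_).symm
          exact Set.inter_subset_right.trans (disjointed_subset B n)
        · exact fun i j hij => ((disjoint_disjointed B) hij).mono Set.inter_subset_right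
            Set.inter_subset_right
        · exact fun n => hT.inter (hBm n)
    rw [heq]
    refine Measurable.tsum fun n => ?_
    exact (Measure.measurable_coe (hT.inter (hBm n))).comp (hκ _)
  rintro S ⟨T, hT, rfl⟩
  -- Off `N` the map `κ'` is the inclusion into measures; the part inside `N` is null and so lies in
  -- `𝒢`.
  have h1 : (Subtype.val ⁻¹' T : Set (PointMeasure d m)) =
      (κ' ⁻¹' T ∩ Nᶜ) ∪ (Subtype.val ⁻¹' T ∩ N) := by
    ext ν
    change ν.1 ∈ T ↔ (κ' ν ∈ T ∧ ν ∉ N) ∨ (ν.1 ∈ T ∧ ν ∈ N)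
    by_cases h : ν ∈ N <;> simp [κ', h]
  refine h1 ▸ ?_
  refine MeasurableSet.union ((hκ' hT).inter hN𝒢.compl) ?_
  exact hnull _ (@MeasurableSet.inter _ (instMeasurableSpacePointMeasure d m) _ _
    (measurable_pointMeasure_val hT) hNm)
    (measure_mono_null Set.inter_subset_right hN0)

end Recovery

end ColouredPointProcess

end

noncomputable section

namespace ColouredPointProcess

open scoped NNReal Topology ContDiff

/-! ### Density of the generated algebra -/

section Density

variable {d m : ℕ} {μ : Measure (PointMeasure d m)}
  {w : Fin m → ℝ} {σ : Measure (Space d)} [σ.HasTemperateGrowth]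
  {θ : Lp ℂ 2 σ →ₗᵢ[ℂ] Lp ℂ 2 μ}

theorem IsDiffractionEmbedding.ae_eq (hθ : IsDiffractionEmbedding μ w σ θ) (φ : 𝓢(Space d, ℂ)) :
    θ (φ.toLp 2 σ) =ᵐ[μ] weightedCount w (𝓕⁻ φ : 𝓢(Space d, ℂ)) := by
  have h := hθ (𝓕⁻ φ)
  rwa [FourierTransform.fourier_fourierInv_eq] at h

theorem IsDiffractionEmbedding.mem_generatedAlgebra (hθ : IsDiffractionEmbedding μ w σ θ)
    (f : 𝓢(Space d, ℂ)) : (weightedCount w f : PointMeasure d m → ℂ) ∈ generatedAlgebra θ :=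
  Algebra.subset_adjoin ⟨𝓕 f, (hθ f).symm⟩

variable [IsProbabilityMeasure μ]

theorem IsDiffractionEmbedding.isBoundedAlgebra (hθ : IsDiffractionEmbedding μ w σ θ) {C : ℝ≥0}
    (hC : ∀ᵐ ν ∂μ, DecayBounded C ν) : IsBoundedAlgebra μ (generatedAlgebra θ) := by
  intro F hF
  induction hF using Algebra.adjoin_induction with
  | mem F hF =>
    obtain ⟨φ, hφ⟩ := hF
    have h := hφ.trans (hθ.ae_eq φ)
    refine ⟨((memLp_weightedCount hC w _ 2).1).congr h.symm, |weightBound w * decayConst (𝓕⁻ φ) * C|,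
      abs_nonneg _, ?_⟩
    filter_upwards [h, hC] with ν h1 h2
    rw [h1]
    exact (norm_weightedCount_le w h2 _).trans (le_abs_self _)
  | algebraMap c =>
    exact ⟨aestronglyMeasurable_const, ‖c‖, norm_nonneg _, ae_of_all _ fun _ => le_rfl⟩
  | add F G _ _ hF hG =>
    obtain ⟨hFm, a, ha0, ha⟩ := hF
    obtain ⟨hGm, b, hb0, hb⟩ := hG
    refine ⟨hFm.add hGm, a + b, by positivity, ?_⟩
    filter_upwards [ha, hb] with ν h1 h2
    exact (norm_add_le _ _).trans (add_le_add h1 h2)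
  | mul F G _ _ hF hG =>
    obtain ⟨hFm, a, ha0, ha⟩ := hF
    obtain ⟨hGm, b, hb0, hb⟩ := hG
    refine ⟨hFm.mul hGm, a * b, by positivity, ?_⟩
    filter_upwards [ha, hb] with ν h1 h2
    rw [Pi.mul_apply, norm_mul]
    exact mul_le_mul h1 h2 (norm_nonneg _) ha0

theorem IsBoundedAlgebra.memLp {Ω : Type*} [MeasurableSpace Ω] {μ : Measure Ω}
    [IsFiniteMeasure μ] {A : Subalgebra ℂ (Ω → ℂ)} (hA : IsBoundedAlgebra μ A) {F : Ω → ℂ}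
    (hF : F ∈ A) (p : ℝ≥0∞) : MemLp F p μ := by
  obtain ⟨hm, c, -, hc⟩ := hA F hF
  exact MemLp.of_bound hm c hc

theorem IsDiffractionEmbedding.dense_generatedAlgebra (hθ : IsDiffractionEmbedding μ w σ θ)
    (hμ : IsUniformlyDiscrete μ) (hinj : Function.Injective w) (hne : ∀ i, w i ≠ 0) :
    Dense {G : Lp ℂ 2 μ | ∃ F ∈ generatedAlgebra θ, G =ᵐ[μ] F} := by
  obtain ⟨C, hC⟩ := exists_decayBounded hμ
  have hA := hθ.isBoundedAlgebra hC
  have hreal : ∀ (f : Space d → ℝ) (hc : HasCompactSupport f) (hs : ContDiff ℝ ∞ f),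
      (weightedCount w (realTestFunction hc hs) : PointMeasure d m → ℂ) =
        fun ν => (realCount w f ν : ℂ) :=
    fun f hc hs => funext fun ν => weightedCount_ofReal w f ν
  have hmeas : ∀ f : Space d → ℝ, HasCompactSupport f → ContDiff ℝ ∞ f →
      Measurable (realCount w f : PointMeasure d m → ℝ) := by
    intro f hc hs
    have h := (stronglyMeasurable_weightedCount (m := m) w
      (realTestFunction hc hs).continuous.measurable).measurable
    rw [hreal] at h
    exact Complex.measurable_re.comp h
  refine EMetric.dense_iff.2 fun G ε hε => ?_
  have hε2 : ε / 2 ≠ 0 := by simpa using hε.ne'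
  obtain ⟨F, hFε, hF⟩ := exists_mem_eLpNorm_sub_le hA
    (fun 𝒢 hnull hall => measurableSpace_le_of_measurable_realCount hμ hinj hne 𝒢 hnull
      fun f hc hs => hall _ (hmeas f hc hs) (by
        rw [← hreal f hc hs]
        exact hθ.mem_generatedAlgebra _))
    (Lp.memLp G) hε2
  have hFL := hA.memLp hF 2
  -- The strict inequality `ε / 2 < ε` fails for the infinite radius, where every element is close
  -- enough.
  by_cases htop : ε = ⊤
  · exact ⟨hFL.toLp, by simp [htop], F, hF, hFL.coeFn_toLp⟩
  refine ⟨hFL.toLp, ?_, F, hF, hFL.coeFn_toLp⟩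
  rw [Metric.mem_eball, edist_comm, Lp.edist_def]
  refine lt_of_le_of_lt ?_ (ENNReal.half_lt_self hε.ne' htop)
  refine (eLpNorm_congr_ae ?_).trans_le hFε
  exact (EventuallyEq.refl _ _).sub hFL.coeFn_toLp

end Density

end ColouredPointProcess

end

theorem theorem6p1 (d m : ℕ)
    (μ : Measure (ColouredPointProcess.PointMeasure d m)) [IsProbabilityMeasure μ]
    (hμ_disc : ColouredPointProcess.IsUniformlyDiscrete μ)
    (hμ_stat : VAddInvariantMeasure (ColouredPointProcess.Space d)
      (ColouredPointProcess.PointMeasure d m) μ)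
    (hμ_erg : ErgodicVAdd (ColouredPointProcess.Space d)
      (ColouredPointProcess.PointMeasure d m) μ)
    (w : Fin m → ℝ) (hw_inj : Function.Injective w) (hw_ne : ∀ i, w i ≠ 0) :
    (∃ (σ : Measure (ColouredPointProcess.Space d)) (_ : σ.HasTemperateGrowth)
        (θ : Lp ℂ 2 σ →ₗᵢ[ℂ] Lp ℂ 2 μ),
        ColouredPointProcess.IsDiffraction μ w σ ∧
        ColouredPointProcess.IsDiffractionEmbedding μ w σ θ) ∧
    ∀ (σ : Measure (ColouredPointProcess.Space d)) [σ.HasTemperateGrowth]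
      (θ : Lp ℂ 2 σ →ₗᵢ[ℂ] Lp ℂ 2 μ),
      ColouredPointProcess.IsDiffraction μ w σ →
      ColouredPointProcess.IsDiffractionEmbedding μ w σ θ →
      (∀ F ∈ ColouredPointProcess.generatedAlgebra θ, MemLp F 2 μ) ∧
      Dense {G : Lp ℂ 2 μ | ∃ F ∈ ColouredPointProcess.generatedAlgebra θ, G =ᵐ[μ] F} := by
  obtain ⟨C, hC⟩ := ColouredPointProcess.exists_decayBounded hμ_disc
  constructor
  · obtain ⟨σ, hσ, _, hdiff⟩ := ColouredPointProcess.exists_diffraction hC w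
    obtain ⟨θ, hθ⟩ := ColouredPointProcess.exists_diffractionEmbedding hC w σ hdiff
    exact ⟨σ, hσ, θ, hdiff, hθ⟩
  · intro σ _ θ _ hθ
    exact ⟨fun F hF => (hθ.isBoundedAlgebra hC).memLp hF 2,
      hθ.dense_generatedAlgebra hμ_disc hw_inj hw_ne⟩
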